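/- Let $\mathbb K$ be a field, $d\ge 0$ an integer, $\mathcal A$ a $\mathbb K$-algebra isomorphic to the algebra of all $(d+1)\times(d+1)$ matrices over $\mathbb K$, $\mathrm{tr}$ its (matrix) trace, and $V$ an irreducible left $\mathcal A$-module. An element of $\mathcal A$ is multiplicity-free if it has $d+1$ distinct eigenvalues $\theta_0,\dots,\theta_d$ in $\mathbb K$; its primitive idempotents are then $E_i=\prod_{j\ne i}\frac{A-\theta_jI}{\theta_i-\theta_j}$. A Leonard system $\Phi=(A;\{E_i\}_{i=0}^d;A^*;\{E^*_i\}_{i=0}^d)$ in $\mathcal A$ consists of multiplicity-free elements $A,A^*$, an ordering $\{E_i\}$ of the primitive idempotents of $A$ and an ordering $\{E^*_i\}$ of those of $A^*$ such that each of $E_iA^*E_j$ and $E^*_iAE^*_j$ is zero if $|i-j|>1$ and nonzero if $|i-j|=1$. Let $\theta_i$ (resp. $\theta^*_i$) be the eigenvalue of $A$ (resp. $A^*$) associated with $E_i$ (resp. $E^*_i$). Put $$\tau_i=\prod_{j=0}^{i-1}(\lambda-\theta_j),\quad \eta_i=\prod_{j=0}^{i-1}(\lambda-\theta_{d-j}),\quad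 \tau^*_i=\prod_{j=0}^{i-1}(\lambda-\theta^*_j),\quad \eta^*_i=\prod_{j=0}^{i-1}(\lambda-\theta^*_{d-j}),$$ and $\phi=\phi_1\cdots\phi_d$, where $\phi_i=(\theta^*_0-\theta^*_i)\,\mathrm{tr}(\eta_i(A)E^*_0)/\mathrm{tr}(\eta_{i-1}(A)E^*_0)$. Let $\xi_0\in E_0V$, $\xi_d\in E_dV$, $\xi^*_0\in E^*_0V$, $\xi^*_d\in E^*_dV$ be nonzero vectors. Then $\mathrm{tr}(E_rE^*_0)\neq0$ for $0\le r\le d$ and $\phi\ne0$. Moreover there are an antiautomorphism $\dagger$ of $\mathcal A$ that fixes $A$ and $A^*$, and a nonzero bilinear form $\langle\,,\rangle$ on $V$ with $\langle Xu,v\rangle=\langle u,X^\dagger v\rangle$ for all $X\in\mathcal A$ and $u,v\in V$. For every such form $\langle\xi_0,\xi^*_0\rangle$ and $\langle\xi_d,\xi^*_0\rangle$ are nonzero, and (i), (ii) below hold. There, "$T:\{u_i\}\to\{v_i\}$" means that $\{u_i\}_{i=0}^d$ and $\{v_i\}_{i=0}^d$ are bases of $V$ and that $T$ acts on $V$ as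 the transition map from the first to the second, i.e. $Tu_i=v_i$ for $0\le i\le d$. (i) If $\{X_i\}_{i=0}^d$ is one of $\{E_i\}$, $\{E_{d-i}\}$, $\{\tau_i(A)\}$, $\{\tau_{d-i}(A)\}$, $\{\eta_i(A)\}$, $\{\eta_{d-i}(A)\}$, then $$\sum_{r=0}^d\frac{X_rE^*_0E_r}{\mathrm{tr}(E_rE^*_0)}:\ \{E_i\xi^*_0\}\to\{X_i\xi^*_0\},$$ $$\frac{\tau^*_d(\theta^*_d)}{\phi}\frac{\langle\xi_d,\xi^*_d\rangle}{\langle\xi_d,\xi^*_0\rangle}\sum_{r=0}^d\tau_r(\theta_r)\eta_{d-r}(\theta_r)X_rE^*_dE_r:\ \{E_i\xi^*_0\}\to\{X_i\xi^*_d\},$$ $$\sum_{r=0}^d\frac{X_{d-r}E^*_0E_r}{\mathrm{tr}(E_rE^*_0)}:\ \{E_{d-i}\xi^*_0\}\to\{X_i\xi^*_0\},$$ $$\frac{\tau^*_d(\theta^*_d)}{\phi}\frac{\langle\xi_d,\xi^*_d\rangle}{\langle\xi_d,\xi^*_0\rangle}\sum_{r=0}^d\tau_r(\theta_r)\eta_{d-r}(\theta_r)X_{d-r}E^*_dE_r:\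 \{E_{d-i}\xi^*_0\}\to\{X_i\xi^*_d\}.$$ (ii) If $\{X_i\}_{i=0}^d$ is one of $\{E^*_i\}$, $\{E^*_{d-i}\}$, $\{\tau^*_i(A^*)\}$, $\{\tau^*_{d-i}(A^*)\}$, $\{\eta^*_i(A^*)\}$, $\{\eta^*_{d-i}(A^*)\}$, then $$\frac{\langle\xi_0,\xi_0\rangle}{\langle\xi_0,\xi^*_0\rangle}\sum_{r=0}^d\frac{X_rE_0E^*_0E_r}{\mathrm{tr}(E_rE^*_0)}:\ \{E_i\xi^*_0\}\to\{X_i\xi_0\},$$ $$\frac{\langle\xi_d,\xi_d\rangle}{\langle\xi_d,\xi^*_0\rangle}\sum_{r=0}^d\frac{X_rE_dE^*_0E_r}{\mathrm{tr}(E_rE^*_0)}:\ \{E_i\xi^*_0\}\to\{X_i\xi_d\},$$ $$\frac{\langle\xi_0,\xi_0\rangle}{\langle\xi_0,\xi^*_0\rangle}\sum_{r=0}^d\frac{X_{d-r}E_0E^*_0E_r}{\mathrm{tr}(E_rE^*_0)}:\ \{E_{d-i}\xi^*_0\}\to\{X_i\xi_0\},$$ $$\frac{\langle\xi_d,\xi_d\rangle}{\langle\xi_d,\xi^*_0\rangle}\sum_{r=0}^d\frac{X_{d-r}E_dE^*_0E_r}{\mathrm{tr}(E_rE^*_0)}:\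 \{E_{d-i}\xi^*_0\}\to\{X_i\xi_d\}.$$ -/

import Mathlib

open Polynomial

/-- `tauPoly θ i = (X - θ_0)(X - θ_1)⋯(X - θ_{i-1})`. -/
noncomputable def tauPoly {K : Type*} [Field K] {d : ℕ} (θ : Fin (d + 1) → K) (i : ℕ) : K[X] :=
  ∏ j ∈ Finset.univ.filter (fun j : Fin (d + 1) => j.val < i), (X - C (θ j))

/-- `etaPoly θ i = (X - θ_d)(X - θ_{d-1})⋯(X - θ_{d-i+1})`. -/
noncomputable def etaPoly {K : Type*} [Field K] {d : ℕ} (θ : Fin (d + 1) → K) (i : ℕ) : K[X] :=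
  ∏ j ∈ Finset.univ.filter (fun j : Fin (d + 1) => j.val < i), (X - C (θ j.rev))

/-- `∏_{j ≠ i} (A - θ_j I) / (θ_i - θ_j)`: when `θ_0, …, θ_d` are the distinct eigenvalues of `A`,
this is the primitive idempotent of `A` associated with `θ_i`. -/
noncomputable def primitiveIdempotent {K 𝒜 : Type*} [Field K] [Ring 𝒜] [Algebra K 𝒜] {d : ℕ}
    (A : 𝒜) (θ : Fin (d + 1) → K) (i : Fin (d + 1)) : 𝒜 :=
  aeval A (∏ j ∈ Finset.univ.erase i, C (θ i - θ j)⁻¹ * (X - C (θ j)))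

/-- The trace on an algebra isomorphic to a full matrix algebra. It does not depend on the
isomorphism `e`, since all automorphisms of a matrix algebra over a field are inner. -/
def algTrace {K 𝒜 : Type*} [Field K] [Ring 𝒜] [Algebra K 𝒜] {d : ℕ}
    (e : 𝒜 ≃ₐ[K] Matrix (Fin (d + 1)) (Fin (d + 1)) K) (x : 𝒜) : K :=
  (e x).trace

/-- A Leonard system `(A; {E_i}; A*; {E*_i})` in a `K`-algebra `𝒜` (which is meant to be isomorphic
to the algebra of `d+1` by `d+1` matrices). The eigenvalue sequence `θ` and the dual eigenvalue
sequence `θs`, which are determined by the other data, are recorded as well. -/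
structure LeonardSystem (K 𝒜 : Type*) [Field K] [Ring 𝒜] [Algebra K 𝒜] (d : ℕ) where
  /-- the element `A` -/
  A : 𝒜
  /-- the ordering `E_0, …, E_d` of the primitive idempotents of `A` -/
  E : Fin (d + 1) → 𝒜
  /-- the element `A*` -/
  As : 𝒜
  /-- the ordering `E*_0, …, E*_d` of the primitive idempotents of `A*` -/
  Es : Fin (d + 1) → 𝒜
  /-- the eigenvalue sequence -/
  θ : Fin (d + 1) → K
  /-- the dual eigenvalue sequence -/
  θs : Fin (d + 1) → K
  θ_injective : Function.Injective θ
  θ_mem_spectrum : ∀ i, θ i ∈ spectrum K A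
  θs_injective : Function.Injective θs
  θs_mem_spectrum : ∀ i, θs i ∈ spectrum K As
  E_eq : ∀ i, E i = primitiveIdempotent A θ i
  Es_eq : ∀ i, Es i = primitiveIdempotent As θs i
  E_As_E_eq_zero : ∀ i j : Fin (d + 1), 1 < |(i : ℤ) - (j : ℤ)| → E i * As * E j = 0
  E_As_E_ne_zero : ∀ i j : Fin (d + 1), |(i : ℤ) - (j : ℤ)| = 1 → E i * As * E j ≠ 0
  Es_A_Es_eq_zero : ∀ i j : Fin (d + 1), 1 < |(i : ℤ) - (j : ℤ)| → Es i * A * Es j = 0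
  Es_A_Es_ne_zero : ∀ i j : Fin (d + 1), |(i : ℤ) - (j : ℤ)| = 1 → Es i * A * Es j ≠ 0

namespace LeonardSystem

variable {K 𝒜 : Type*} [Field K] [Ring 𝒜] [Algebra K 𝒜] {d : ℕ}

/-- The polynomial `τ_i`. -/
noncomputable def tau (Φ : LeonardSystem K 𝒜 d) (i : ℕ) : K[X] := tauPoly Φ.θ i

/-- The polynomial `η_i`. -/
noncomputable def eta (Φ : LeonardSystem K 𝒜 d) (i : ℕ) : K[X] := etaPoly Φ.θ i

/-- The polynomial `τ*_i`. -/
noncomputable def taus (Φ : LeonardSystem K 𝒜 d) (i : ℕ) : K[X] := tauPoly Φ.θs i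

/-- The polynomial `η*_i`. -/
noncomputable def etas (Φ : LeonardSystem K 𝒜 d) (i : ℕ) : K[X] := etaPoly Φ.θs i

/-- The second split sequence, `ϕ_i = (θ*_0 - θ*_i) tr(η_i(A) E*_0) / tr(η_{i-1}(A) E*_0)` for
`1 ≤ i ≤ d`. Here `i : Fin d` stands for the index `i + 1`. -/
noncomputable def secondSplit (Φ : LeonardSystem K 𝒜 d)
    (e : 𝒜 ≃ₐ[K] Matrix (Fin (d + 1)) (Fin (d + 1)) K) (i : Fin d) : K :=
  (Φ.θs 0 - Φ.θs i.succ) *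
    (algTrace e (aeval Φ.A (Φ.eta (i.val + 1)) * Φ.Es 0) /
      algTrace e (aeval Φ.A (Φ.eta i.val) * Φ.Es 0))

/-- The product `ϕ = ϕ_1 ϕ_2 ⋯ ϕ_d` of the second split sequence. -/
noncomputable def phi (Φ : LeonardSystem K 𝒜 d)
    (e : 𝒜 ≃ₐ[K] Matrix (Fin (d + 1)) (Fin (d + 1)) K) : K :=
  ∏ i : Fin d, Φ.secondSplit e i

/-- `σ` is an antiautomorphism of `𝒜` that fixes `A` and `A*` (there is exactly one, denoted `†`). -/
def IsDagger (Φ : LeonardSystem K 𝒜 d) (σ : 𝒜 ≃ₗ[K] 𝒜) : Prop :=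
  (∀ x y, σ (x * y) = σ y * σ x) ∧ σ Φ.A = Φ.A ∧ σ Φ.As = Φ.As

/-- `b` is a bilinear form on `V` associated with `Φ`: it is nonzero, and
`b (x u) v = b u (x† v)` for all `x` in `𝒜`. Such a form is unique up to a nonzero scalar. -/
def IsAssociatedForm {V : Type*} [AddCommGroup V] [Module K V] [Module 𝒜 V]
    (Φ : LeonardSystem K 𝒜 d) (b : LinearMap.BilinForm K V) : Prop :=
  b ≠ 0 ∧ ∃ σ : 𝒜 ≃ₗ[K] 𝒜, Φ.IsDagger σ ∧
    ∀ (x : 𝒜) (u v : V), b (x • u) v = b u (σ x • v)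

/-- The six sequences `{E_i}`, `{E_{d-i}}`, `{τ_i(A)}`, `{τ_{d-i}(A)}`, `{η_i(A)}`,
`{η_{d-i}(A)}`. -/
def sequencesA (Φ : LeonardSystem K 𝒜 d) : Set (Fin (d + 1) → 𝒜) :=
  {fun i => Φ.E i, fun i => Φ.E i.rev,
   fun i => aeval Φ.A (Φ.tau i.val), fun i => aeval Φ.A (Φ.tau (d - i.val)),
   fun i => aeval Φ.A (Φ.eta i.val), fun i => aeval Φ.A (Φ.eta (d - i.val))}

/-- The six sequences `{E*_i}`, `{E*_{d-i}}`, `{τ*_i(A*)}`, `{τ*_{d-i}(A*)}`, `{η*_i(A*)}`,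
`{η*_{d-i}(A*)}`. -/
def sequencesAs (Φ : LeonardSystem K 𝒜 d) : Set (Fin (d + 1) → 𝒜) :=
  {fun i => Φ.Es i, fun i => Φ.Es i.rev,
   fun i => aeval Φ.As (Φ.taus i.val), fun i => aeval Φ.As (Φ.taus (d - i.val)),
   fun i => aeval Φ.As (Φ.etas i.val), fun i => aeval Φ.As (Φ.etas (d - i.val))}

end LeonardSystem

/-- The action of `T` on `V` is the transition map from `u` to `v`: both `u` and `v` are bases of
`V`, and `T` sends `u_i` to `v_i` for all `i`. -/
def IsTransitionMap (K : Type*) {𝒜 V : Type*} [Field K] [Ring 𝒜] [AddCommGroup V] [Module K V]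
    [Module 𝒜 V] {d : ℕ} (T : 𝒜) (u v : Fin (d + 1) → V) : Prop :=
  (LinearIndependent K u ∧ Submodule.span K (Set.range u) = ⊤) ∧
  (LinearIndependent K v ∧ Submodule.span K (Set.range v) = ⊤) ∧
  ∀ i, T • u i = v i

/-!
Fix `w = ξ*_0`. All four sums of part (i), and all four of part (ii), have the shape
`∑ r, X_r Y E_r` up to scalars, where `Y E_r w` is a multiple, independent of `X`, of the vector
`w'` that occurs in the target basis `X_i w'`. Since `E_r E_i = 0` for `r ≠ i`, such a sum maps
`E_i w` to `X_i w'` as soon as the scalars are right, so everything reduces to computing `Y E_r w`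
and to showing that the sequences in question are bases (`isTransitionMap_sum`).

The computations take place on `V`, which has dimension `d + 1` and on which `𝒜` acts as the full
endomorphism algebra. The idempotent `E_r` is a polynomial in `A` of degree `d` with leading
coefficient `∏_{j ≠ r} (θ_r - θ_j)⁻¹`, and `A` is irreducible tridiagonal with respect to the
eigenspaces of `A*`; hence `E*_d E_r w` is that coefficient times `E*_d A^d w ≠ 0`
(`Es_last_smul_E_smul`). In particular no `E_r w` vanishes, which gives the bases, and applying
the same to the ordering `E*_d, …, E*_0` gives `E*_0 E_r w = tr(E_r E*_0) w ≠ 0`.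

The form is diagonal in an eigenbasis of `A*`, with weights that symmetrize the tridiagonal matrix
of `A`; the antiautomorphism is the adjoint for it (`exists_isAssociatedForm`). For any associated
form the `E_iV` are mutually orthogonal lines, nonisotropic because the radical is a submodule of
the simple module `V`. So `E_i v = (⟨ξ, v⟩ / ⟨ξ, ξ⟩) ξ` for `ξ ∈ E_iV`, which settles part (ii).

For the sums with `E*_d` the scalar `φ` enters. The vectors `η_i(A) w` satisfy
`(A* - θ*_i) η_i(A) w = φ_i η_{i-1}(A) w` with `φ_i ≠ 0` (`As_smul_eta_smul`): the left side lies
both in `E*_0V + ⋯ + E*_{i-1}V` and in `E_0V + ⋯ + E_{d-i+1}V`, and the intersection is the line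
through `η_{i-1}(A) w`; applying `E*_0` identifies the scalar with the trace quotient that defines
`φ_i`. As `ξ_d` is orthogonal to `η_i(A) w` for `i ≥ 1`, pairing with `ξ_d` turns this into
`⟨ξ_d, τ*_d(A*) η_d(A) w⟩ = φ ⟨ξ_d, w⟩`, while `τ*_d(A*) = τ*_d(θ*_d) E*_d` (`phi_mul_form`).
-/

/-! ### The simple module of a matrix algebra -/

section Module

variable {K 𝒜 V : Type*} [Field K] [Ring 𝒜] [Algebra K 𝒜]
  [AddCommGroup V] [Module K V] [Module 𝒜 V] [IsScalarTower K 𝒜 V] [IsSimpleModule 𝒜 V] {d : ℕ}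

/-- The simple module is the module of column vectors. If the matrix unit `e_ii` does not annihilate
`v`, then `c ↦ (∑ j, c_j e_ji) v` is an isomorphism. -/
theorem exists_coordEquiv (V : Type*) [AddCommGroup V] [Module K V] [Module 𝒜 V]
    [IsScalarTower K 𝒜 V] [IsSimpleModule 𝒜 V]
    (e : 𝒜 ≃ₐ[K] Matrix (Fin (d + 1)) (Fin (d + 1)) K) :
    ∃ φ : (Fin (d + 1) → K) ≃ₗ[K] V, ∀ x c, φ ((e x).mulVec c) = x • φ c := by
  have := IsSimpleModule.nontrivial 𝒜 V
  obtain ⟨v, hv⟩ := exists_ne (0 : V)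
  obtain ⟨i, hi⟩ : ∃ i, e.symm (Matrix.vecMulVec (Pi.single i 1) (Pi.single i 1)) • v ≠ 0 := by
    by_contra! h
    apply hv
    have h1 : ∑ i, Matrix.vecMulVec (Pi.single i 1) (Pi.single i 1) =
        (1 : Matrix (Fin (d + 1)) (Fin (d + 1)) K) := by
      ext a b
      simp [Matrix.sum_apply, Matrix.vecMulVec_apply, Matrix.one_apply, Pi.single_apply]
    rw [← one_smul 𝒜 v, ← map_one e.symm, ← h1, map_sum, Finset.sum_smul]
    simp [h]
  let f : (Fin (d + 1) → K) →ₗ[K] V :=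
    { toFun := fun c => e.symm (Matrix.vecMulVec c (Pi.single i 1)) • v
      map_add' := fun c c' => by rw [Matrix.add_vecMulVec, map_add, add_smul]
      map_smul' := fun k c => by rw [Matrix.smul_vecMulVec, map_smul, smul_assoc]; rfl }
  have hf : ∀ x c, f ((e x).mulVec c) = x • f c := by
    intro x c
    change e.symm _ • v = x • e.symm _ • v
    rw [smul_smul, ← Matrix.mul_vecMulVec, map_mul, e.symm_apply_apply]
  have hinj : Function.Injective f := by
    rw [← LinearMap.ker_eq_bot, LinearMap.ker_eq_bot']
    intro c hc
    ext k
    have h1 := hf (e.symm (Matrix.vecMulVec (Pi.single i 1) (Pi.single k 1))) c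
    rw [hc, smul_zero, e.apply_symm_apply, Matrix.vecMulVec_mulVec] at h1
    simp only [single_dotProduct, one_mul, op_smul_eq_smul, map_smul] at h1
    exact (smul_eq_zero.1 h1).resolve_right hi
  have hsurj : Function.Surjective f := by
    let N : Submodule 𝒜 V :=
      { carrier := Set.range f
        add_mem' := by rintro _ _ ⟨a, rfl⟩ ⟨b, rfl⟩; exact ⟨a + b, map_add _ _ _⟩
        zero_mem' := ⟨0, map_zero _⟩
        smul_mem' := by rintro x _ ⟨a, rfl⟩; exact ⟨_, hf x a⟩ }
    have hN : N = ⊤ := by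
      refine (eq_bot_or_eq_top N).resolve_left fun h => hi ?_
      have : f (Pi.single i 1) ∈ N := ⟨_, rfl⟩
      rw [h] at this
      exact this
    intro w
    have : w ∈ N := hN ▸ Submodule.mem_top
    exact this
  exact ⟨LinearEquiv.ofBijective f ⟨hinj, hsurj⟩, hf⟩

/-- `𝒜` acts on `V` as the algebra of all endomorphisms, and `algTrace` is the trace of the action. -/
theorem exists_actionEquiv (V : Type*) [AddCommGroup V] [Module K V] [Module 𝒜 V]
    [IsScalarTower K 𝒜 V] [IsSimpleModule 𝒜 V]
    (e : 𝒜 ≃ₐ[K] Matrix (Fin (d + 1)) (Fin (d + 1)) K) :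
    ∃ ρ : 𝒜 ≃ₐ[K] Module.End K V, (∀ x v, ρ x v = x • v) ∧
      ∀ x, LinearMap.trace K V (ρ x) = algTrace e x := by
  obtain ⟨φ, hφ⟩ := exists_coordEquiv V e
  refine ⟨(e.trans Matrix.toLinAlgEquiv').trans (φ.conjAlgEquiv K), fun x v => ?_, fun x => ?_⟩
  · obtain ⟨c, rfl⟩ := φ.surjective v
    rw [← hφ]
    simp [LinearEquiv.conjAlgEquiv_apply]
  · have : ((e.trans Matrix.toLinAlgEquiv').trans (φ.conjAlgEquiv K)) x =
        φ.conj (Matrix.toLin' (e x)) := rfl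
    rw [this, LinearMap.trace_conj', Matrix.trace_toLin'_eq]
    rfl

theorem finrank_eq_of_matrixAlgEquiv (V : Type*) [AddCommGroup V] [Module K V] [Module 𝒜 V]
    [IsScalarTower K 𝒜 V] [IsSimpleModule 𝒜 V]
    (e : 𝒜 ≃ₐ[K] Matrix (Fin (d + 1)) (Fin (d + 1)) K) :
    FiniteDimensional K V ∧ Module.finrank K V = d + 1 := by
  obtain ⟨φ, -⟩ := exists_coordEquiv V e
  exact ⟨Module.Finite.equiv φ, by rw [← φ.finrank_eq]; simp⟩

theorem ext_of_smul (V : Type*) [AddCommGroup V] [Module K V] [Module 𝒜 V]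
    [IsScalarTower K 𝒜 V] [IsSimpleModule 𝒜 V]
    (e : 𝒜 ≃ₐ[K] Matrix (Fin (d + 1)) (Fin (d + 1)) K) {x y : 𝒜}
    (h : ∀ v : V, x • v = y • v) : x = y := by
  obtain ⟨ρ, hρ, -⟩ := exists_actionEquiv V e
  exact ρ.injective (LinearMap.ext fun v => by rw [hρ, hρ, h])

omit [IsSimpleModule 𝒜 V] in
theorem aeval_smul_of_smul_eq {A : 𝒜} {t : K} {v : V} (h : A • v = t • v) (p : K[X]) :
    aeval A p • v = p.eval t • v := by
  induction p using Polynomial.induction_on' with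
  | add p q hp hq => rw [map_add, add_smul, hp, hq, eval_add, add_smul]
  | monomial n a =>
    rw [aeval_monomial, eval_monomial, mul_smul, mul_smul, algebraMap_smul]
    congr 1
    induction n with
    | zero => simp
    | succ n ih => rw [pow_succ, mul_smul, h, smul_comm, ih, smul_smul, pow_succ, mul_comm]

end Module

/-! ### Dual and reversed Leonard systems -/

theorem primitiveIdempotent_eq {K 𝒜 : Type*} [Field K] [Ring 𝒜] [Algebra K 𝒜] {d : ℕ}
    (A : 𝒜) (θ : Fin (d + 1) → K) (i : Fin (d + 1)) :
    primitiveIdempotent A θ i = aeval A (Lagrange.basis Finset.univ θ i) := rfl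

namespace LeonardSystem

/-- The Leonard system `(A*; {E*_i}; A; {E_i})`. -/
def dual {K 𝒜 : Type*} [Field K] [Ring 𝒜] [Algebra K 𝒜] {d : ℕ} (Φ : LeonardSystem K 𝒜 d) :
    LeonardSystem K 𝒜 d where
  A := Φ.As
  E := Φ.Es
  As := Φ.A
  Es := Φ.E
  θ := Φ.θs
  θs := Φ.θ
  θ_injective := Φ.θs_injective
  θ_mem_spectrum := Φ.θs_mem_spectrum
  θs_injective := Φ.θ_injective
  θs_mem_spectrum := Φ.θ_mem_spectrum
  E_eq := Φ.Es_eq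
  Es_eq := Φ.E_eq
  E_As_E_eq_zero := Φ.Es_A_Es_eq_zero
  E_As_E_ne_zero := Φ.Es_A_Es_ne_zero
  Es_A_Es_eq_zero := Φ.E_As_E_eq_zero
  Es_A_Es_ne_zero := Φ.E_As_E_ne_zero

theorem primitiveIdempotent_rev {K 𝒜 : Type*} [Field K] [Ring 𝒜] [Algebra K 𝒜] {d : ℕ}
    (A : 𝒜) (θ : Fin (d + 1) → K) (i : Fin (d + 1)) :
    primitiveIdempotent A (θ ∘ Fin.rev) i = primitiveIdempotent A θ i.rev := by
  unfold primitiveIdempotent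
  congr 1
  refine Finset.prod_bij (fun j _ => j.rev) ?_ ?_ ?_ ?_
  · intro j hj; simpa [Fin.rev_eq_iff] using hj
  · intro j _ k _ h; exact Fin.rev_injective h
  · intro j hj
    exact ⟨j.rev, by simpa [Fin.rev_eq_iff] using hj, Fin.rev_rev j⟩
  · intro j _; rfl

theorem abs_rev_sub_rev {d : ℕ} (i j : Fin (d + 1)) :
    |((i.rev : Fin (d + 1)) : ℤ) - (j.rev : Fin (d + 1))| = |(i : ℤ) - j| := by
  have h : ∀ k : Fin (d + 1), ((k.rev : Fin (d + 1)) : ℤ) = d - k := fun k => by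
    rw [Fin.val_rev]; omega
  rw [h, h, abs_sub_comm]; congr 1; ring

/-- The Leonard system `(A; {E_i}; A*; {E*_{d-i}})`. -/
def revDual {K 𝒜 : Type*} [Field K] [Ring 𝒜] [Algebra K 𝒜] {d : ℕ} (Φ : LeonardSystem K 𝒜 d) :
    LeonardSystem K 𝒜 d where
  A := Φ.A
  E := Φ.E
  As := Φ.As
  Es := Φ.Es ∘ Fin.rev
  θ := Φ.θ
  θs := Φ.θs ∘ Fin.rev
  θ_injective := Φ.θ_injective
  θ_mem_spectrum := Φ.θ_mem_spectrum
  θs_injective := Φ.θs_injective.comp Fin.rev_injective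
  θs_mem_spectrum i := Φ.θs_mem_spectrum i.rev
  E_eq := Φ.E_eq
  Es_eq i := (Φ.Es_eq i.rev).trans (primitiveIdempotent_rev _ _ _).symm
  E_As_E_eq_zero := Φ.E_As_E_eq_zero
  E_As_E_ne_zero := Φ.E_As_E_ne_zero
  Es_A_Es_eq_zero i j h := Φ.Es_A_Es_eq_zero i.rev j.rev (by rwa [abs_rev_sub_rev])
  Es_A_Es_ne_zero i j h := Φ.Es_A_Es_ne_zero i.rev j.rev (by rwa [abs_rev_sub_rev])

/-! ### The primitive idempotents as projections onto the eigenlines -/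

section Idempotents

variable {K 𝒜 : Type*} [Field K] [Ring 𝒜] [Algebra K 𝒜] {d : ℕ}

/-- `A` has an eigenbasis on `V`, and `E_i` is the projection onto its `i`-th line. -/
theorem exists_eigenbasis (V : Type*) [AddCommGroup V] [Module K V] [Module 𝒜 V]
    [IsScalarTower K 𝒜 V] [IsSimpleModule 𝒜 V]
    (e : 𝒜 ≃ₐ[K] Matrix (Fin (d + 1)) (Fin (d + 1)) K) (Φ : LeonardSystem K 𝒜 d) :
    ∃ b : Module.Basis (Fin (d + 1)) K V, (∀ i, Φ.A • b i = Φ.θ i • b i) ∧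
      ∀ i v, Φ.E i • v = b.repr v i • b i := by
  obtain ⟨ρ, hρ, -⟩ := exists_actionEquiv V e
  obtain ⟨hfin, hrank⟩ := finrank_eq_of_matrixAlgEquiv V e
  have hex : ∀ i, ∃ v, Module.End.HasEigenvector (ρ Φ.A) (Φ.θ i) v := fun i =>
    (Module.End.hasEigenvalue_iff_mem_spectrum.2
      (by rw [AlgEquiv.spectrum_eq]; exact Φ.θ_mem_spectrum i)).exists_hasEigenvector
  choose w hw using hex
  have hli : LinearIndependent K w :=
    Module.End.eigenvectors_linearIndependent' (ρ Φ.A) Φ.θ Φ.θ_injective w hw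
  let b := basisOfLinearIndependentOfCardEqFinrank hli (by simp [hrank])
  have hb : ∀ i, b i = w i := fun i => by simp [b]
  have hA : ∀ i, Φ.A • b i = Φ.θ i • b i := fun i => by
    rw [hb, ← hρ]; exact (hw i).apply_eq_smul
  refine ⟨b, hA, fun i v => ?_⟩
  conv_lhs => rw [← b.sum_repr v, Finset.smul_sum]
  rw [Finset.sum_eq_single i]
  · rw [Φ.E_eq, primitiveIdempotent_eq, smul_comm, aeval_smul_of_smul_eq (hA i),
      Lagrange.eval_basis_self Φ.θ_injective.injOn (Finset.mem_univ i), one_smul]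
  · intro j _ hj
    rw [Φ.E_eq, primitiveIdempotent_eq, smul_comm, aeval_smul_of_smul_eq (hA j),
      Lagrange.eval_basis_of_ne hj.symm (Finset.mem_univ j), zero_smul, smul_zero]
  · simp

variable {V : Type*} [AddCommGroup V] [Module K V] [Module 𝒜 V]
    [IsScalarTower K 𝒜 V] [IsSimpleModule 𝒜 V]
    (e : 𝒜 ≃ₐ[K] Matrix (Fin (d + 1)) (Fin (d + 1)) K) (Φ : LeonardSystem K 𝒜 d)

include e

theorem aeval_smul (p : K[X]) (i : Fin (d + 1)) (v : V) :
    aeval Φ.A p • Φ.E i • v = p.eval (Φ.θ i) • Φ.E i • v := by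
  obtain ⟨b, hb, hE⟩ := Φ.exists_eigenbasis V e
  rw [hE, smul_comm, aeval_smul_of_smul_eq (hb i), smul_comm]

theorem E_smul_E_smul (i j : Fin (d + 1)) (v : V) :
    Φ.E i • Φ.E j • v = if i = j then Φ.E j • v else 0 := by
  obtain ⟨b, hb, hE⟩ := Φ.exists_eigenbasis V e
  split_ifs with h
  · subst h; simp [hE]
  · simp [hE, Ne.symm h]

theorem sum_E_smul (v : V) : ∑ i, Φ.E i • v = v := by
  obtain ⟨b, hb, hE⟩ := Φ.exists_eigenbasis V e
  simp_rw [hE]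
  exact b.sum_repr v

theorem E_smul_aeval_smul (p : K[X]) (i : Fin (d + 1)) (v : V) :
    Φ.E i • aeval Φ.A p • v = p.eval (Φ.θ i) • Φ.E i • v := by
  rw [← aeval_smul e, Φ.E_eq, primitiveIdempotent_eq, smul_smul, smul_smul, ← map_mul, ← map_mul,
    mul_comm]

theorem eq_of_E_smul_eq {v w : V} (h : ∀ i, Φ.E i • v = Φ.E i • w) : v = w := by
  rw [← Φ.sum_E_smul e v, ← Φ.sum_E_smul e w]
  exact Finset.sum_congr rfl fun i _ => h i

/-- `E_i` has rank one. -/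
theorem exists_E_smul_eq {i : Fin (d + 1)} {w : V} (hw : Φ.E i • w = w) (h0 : w ≠ 0) (v : V) :
    ∃ c : K, Φ.E i • v = c • w := by
  obtain ⟨b, hb, hE⟩ := Φ.exists_eigenbasis V e
  rw [hE] at hw
  have : b.repr w i ≠ 0 := fun h => h0 (by rw [← hw, h, zero_smul])
  refine ⟨b.repr v i * (b.repr w i)⁻¹, ?_⟩
  calc Φ.E i • v = (b.repr v i * (b.repr w i)⁻¹) • b.repr w i • b i := by
        rw [hE, smul_smul, mul_assoc, inv_mul_cancel₀ this, mul_one]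
    _ = _ := by rw [hw]

/-- As `E_i` has rank one, `E_i x E_i = tr(x E_i) E_i`; here evaluated on `E_iV`. -/
theorem algTrace_smul (x : 𝒜) {i : Fin (d + 1)} {w : V} (hw : Φ.E i • w = w) :
    algTrace e (x * Φ.E i) • w = Φ.E i • x • w := by
  obtain ⟨b, hb, hE⟩ := Φ.exists_eigenbasis V e
  obtain ⟨ρ, hρ, htr⟩ := exists_actionEquiv V e
  have h1 : algTrace e (x * Φ.E i) = b.repr (x • b i) i := by
    rw [← htr, LinearMap.trace_eq_matrix_trace K b, Matrix.trace, Finset.sum_eq_single i]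
    · rw [Matrix.diag_apply, LinearMap.toMatrix_apply, hρ, mul_smul, hE]; simp
    · intro j _ hj
      rw [Matrix.diag_apply, LinearMap.toMatrix_apply, hρ, mul_smul, hE]; simp [hj.symm]
    · simp
  rw [hE] at hw
  generalize b.repr w i = a at hw
  subst hw
  rw [h1, hE, smul_comm x a (b i), LinearEquiv.map_smul b.repr, smul_smul, Finsupp.smul_apply,
    smul_eq_mul, mul_comm]

theorem linearIndependent_span_of_E {u : Fin (d + 1) → V} (h0 : ∀ i, u i ≠ 0)
    (hu : ∀ i, Φ.E i • u i = u i) :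
    LinearIndependent K u ∧ Submodule.span K (Set.range u) = ⊤ := by
  obtain ⟨hfin, hrank⟩ := finrank_eq_of_matrixAlgEquiv V e
  have hli : LinearIndependent K u := by
    rw [Fintype.linearIndependent_iff]
    intro g hg i
    have := congrArg (Φ.E i • ·) hg
    simp only [Finset.smul_sum, smul_zero] at this
    rw [Finset.sum_eq_single i] at this
    · rw [smul_comm, hu] at this
      exact (smul_eq_zero.1 this).resolve_right (h0 i)
    · intro j _ hj
      rw [smul_comm, ← hu j, E_smul_E_smul e, if_neg hj.symm, smul_zero]
    · simp
  exact ⟨hli, hli.span_eq_top_of_card_eq_finrank (by simp [hrank])⟩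

end Idempotents
end LeonardSystem

namespace LeonardSystem

/-! ### The tridiagonal action on the dual eigenspaces -/

section Tridiagonal

variable {K 𝒜 : Type*} [Field K] [Ring 𝒜] [Algebra K 𝒜] {d : ℕ}
  {V : Type*} [AddCommGroup V] [Module K V] [Module 𝒜 V]
  [IsScalarTower K 𝒜 V] [IsSimpleModule 𝒜 V]
  (e : 𝒜 ≃ₐ[K] Matrix (Fin (d + 1)) (Fin (d + 1)) K) (Φ : LeonardSystem K 𝒜 d)

include e

theorem Es_smul_Es_smul (i j : Fin (d + 1)) (v : V) :
    Φ.Es i • Φ.Es j • v = if i = j then Φ.Es j • v else 0 :=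
  Φ.dual.E_smul_E_smul e i j v

theorem sum_Es_smul (v : V) : ∑ i, Φ.Es i • v = v :=
  Φ.dual.sum_E_smul e v

theorem Es_smul_A_smul (j : Fin (d + 1)) (v : V) :
    Φ.Es j • Φ.A • v = ∑ i, (Φ.Es j * Φ.A * Φ.Es i) • v := by
  conv_lhs => rw [← Φ.sum_Es_smul e v]
  simp only [Finset.smul_sum, mul_smul]

/-- Each application of `A` reaches at most one further dual eigenspace. -/
theorem Es_smul_pow_smul_eq_zero {w : V} (hw : Φ.Es 0 • w = w) (k : ℕ) :
    ∀ j : Fin (d + 1), k < j.val → Φ.Es j • Φ.A ^ k • w = 0 := by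
  induction k with
  | zero =>
    intro j hj
    rw [pow_zero, one_smul, ← hw, Es_smul_Es_smul e, if_neg]
    rintro rfl
    simp at hj
  | succ k ih =>
    intro j hj
    rw [pow_succ', mul_smul, Es_smul_A_smul e]
    refine Finset.sum_eq_zero fun i _ => ?_
    by_cases hi : k < i.val
    · rw [mul_smul, ih i hi, smul_zero]
    · rw [Φ.Es_A_Es_eq_zero, zero_smul]
      rw [abs_of_pos] <;> omega

/-- The component of `A^k w` in the last dual eigenspace it can reach is nonzero, being a product of
subdiagonal entries. -/
theorem Es_smul_pow_smul_ne_zero {w : V} (hw : Φ.Es 0 • w = w) (h0 : w ≠ 0) (k : ℕ)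
    (hk : k < d + 1) : Φ.Es ⟨k, hk⟩ • Φ.A ^ k • w ≠ 0 := by
  induction k with
  | zero => simpa using fun h => h0 (hw.symm.trans h)
  | succ k ih =>
    have ih := ih (by omega)
    rw [pow_succ', mul_smul, Es_smul_A_smul e, Finset.sum_eq_single ⟨k, by omega⟩]
    · intro h
      refine Φ.Es_A_Es_ne_zero ⟨k + 1, hk⟩ ⟨k, by omega⟩ (by simp) (ext_of_smul V e fun v => ?_)
      obtain ⟨c, hc⟩ := Φ.dual.exists_E_smul_eq e (i := ⟨k, by omega⟩)
        ((Φ.Es_smul_Es_smul e _ _ _).trans (if_pos rfl)) ih v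
      change Φ.Es _ • v = _ at hc
      rw [mul_smul, hc, smul_comm, zero_smul]
      rw [mul_smul] at h
      rw [h, smul_zero]
    · intro i _ hi
      by_cases hki : k < i.val
      · rw [mul_smul, Φ.Es_smul_pow_smul_eq_zero e hw k i hki, smul_zero]
      · rw [Φ.Es_A_Es_eq_zero, zero_smul]
        have : i.val ≠ k := fun h => hi (Fin.ext h)
        rw [abs_of_pos] <;> push_cast <;> omega
    · simp

theorem Es_smul_aeval_smul {w : V} (hw : Φ.Es 0 • w = w) {p : K[X]} {k : Fin (d + 1)}
    (hp : p.natDegree ≤ k) :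
    Φ.Es k • aeval Φ.A p • w = p.coeff k • Φ.Es k • Φ.A ^ (k : ℕ) • w := by
  rw [aeval_eq_sum_range' (Nat.lt_succ_of_le hp), Finset.sum_smul, Finset.smul_sum,
    Finset.sum_range_succ, Finset.sum_eq_zero, zero_add, smul_assoc, smul_comm]
  intro i hi
  rw [smul_assoc, smul_comm, Φ.Es_smul_pow_smul_eq_zero e hw i k (Finset.mem_range.1 hi), smul_zero]

theorem Es_smul_aeval_smul_eq_zero {w : V} (hw : Φ.Es 0 • w = w) {p : K[X]} {k : Fin (d + 1)}
    (hp : p.natDegree < k) : Φ.Es k • aeval Φ.A p • w = 0 := by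
  rw [Φ.Es_smul_aeval_smul e hw hp.le, coeff_eq_zero_of_natDegree_lt hp, zero_smul]

/-- Only the leading coefficient of `E_r`, as a polynomial in `A` of degree `d`, survives. -/
theorem Es_last_smul_E_smul {w : V} (hw : Φ.Es 0 • w = w) (r : Fin (d + 1)) :
    Φ.Es (Fin.last d) • Φ.E r • w =
      (∏ j ∈ Finset.univ.erase r, (Φ.θ r - Φ.θ j))⁻¹ • Φ.Es (Fin.last d) • Φ.A ^ d • w := by
  have hd : (Lagrange.basis Finset.univ Φ.θ r).natDegree = d := by
    rw [Lagrange.natDegree_basis Φ.θ_injective.injOn (Finset.mem_univ r)]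
    simp
  rw [Φ.E_eq, primitiveIdempotent_eq, Φ.Es_smul_aeval_smul e hw (by simp [hd])]
  congr 1
  rw [← Lagrange.leadingCoeff_basis Φ.θ_injective.injOn
    (Finset.mem_univ r), leadingCoeff, hd, Fin.val_last]

omit e in
theorem prod_theta_sub_ne_zero (Φ : LeonardSystem K 𝒜 d) (r : Fin (d + 1)) :
    ∏ j ∈ Finset.univ.erase r, (Φ.θ r - Φ.θ j) ≠ 0 :=
  Finset.prod_ne_zero_iff.2 fun _ hj =>
    sub_ne_zero.2 fun h => (Finset.mem_erase.1 hj).1 (Φ.θ_injective h).symm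

theorem Es_last_smul_E_smul_ne_zero {w : V} (hw : Φ.Es 0 • w = w) (h0 : w ≠ 0) (r : Fin (d + 1)) :
    Φ.Es (Fin.last d) • Φ.E r • w ≠ 0 := by
  rw [Φ.Es_last_smul_E_smul e hw]
  exact smul_ne_zero (inv_ne_zero (Φ.prod_theta_sub_ne_zero r))
    (Φ.Es_smul_pow_smul_ne_zero e hw h0 d (by omega))

theorem E_smul_ne_zero {w : V} (hw : Φ.Es 0 • w = w) (h0 : w ≠ 0) (r : Fin (d + 1)) :
    Φ.E r • w ≠ 0 := fun h =>
  Φ.Es_last_smul_E_smul_ne_zero e hw h0 r (by rw [h, smul_zero])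

omit e in
theorem revDual_Es_zero (Φ : LeonardSystem K 𝒜 d) : Φ.revDual.Es 0 = Φ.Es (Fin.last d) :=
  congrArg Φ.Es (Fin.rev_zero d)

omit e in
theorem revDual_Es_last (Φ : LeonardSystem K 𝒜 d) : Φ.revDual.Es (Fin.last d) = Φ.Es 0 :=
  congrArg Φ.Es (Fin.rev_last d)

/-- Both ends of the dual ordering behave alike, by passing to the reversed system. -/
theorem E_smul_ne_zero' {w : V} (hw : Φ.Es (Fin.last d) • w = w) (h0 : w ≠ 0) (r : Fin (d + 1)) :
    Φ.E r • w ≠ 0 :=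
  Φ.revDual.E_smul_ne_zero e (by rwa [revDual_Es_zero]) h0 r

theorem Es_zero_smul_E_smul_ne_zero {w : V} (hw : Φ.Es 0 • w = w) (h0 : w ≠ 0) (r : Fin (d + 1)) :
    Φ.Es 0 • Φ.E r • w ≠ 0 := by
  intro h
  -- `E_r w` spans `E_rV`, so it suffices to find one vector on which `E*_0 E_r` does not vanish;
  -- a vector of `E*_dV` is one, by the reversed system.
  set u : V := Φ.Es (Fin.last d) • Φ.A ^ d • w
  have hu0 : u ≠ 0 := Φ.Es_smul_pow_smul_ne_zero e hw h0 d (by omega)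
  have hu : Φ.Es (Fin.last d) • u = u := by simp [u, Es_smul_Es_smul e]
  have h1 : Φ.Es 0 • Φ.E r • u ≠ 0 := by
    rw [← revDual_Es_last]
    exact Φ.revDual.Es_last_smul_E_smul_ne_zero e (by rwa [revDual_Es_zero]) hu0 r
  obtain ⟨c, hc⟩ := Φ.exists_E_smul_eq e (by rw [E_smul_E_smul e, if_pos rfl])
    (Φ.E_smul_ne_zero e hw h0 r) u
  rw [hc, smul_comm, h, smul_zero] at h1
  exact h1 rfl

theorem Es_zero_smul_E_smul {w : V} (hw : Φ.Es 0 • w = w) (r : Fin (d + 1)) :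
    Φ.Es 0 • Φ.E r • w = algTrace e (Φ.E r * Φ.Es 0) • w :=
  (Φ.dual.algTrace_smul e (Φ.E r) hw).symm

theorem algTrace_E_mul_Es_zero_ne_zero {w : V} (hw : Φ.Es 0 • w = w) (h0 : w ≠ 0)
    (r : Fin (d + 1)) : algTrace e (Φ.E r * Φ.Es 0) ≠ 0 := fun h =>
  Φ.Es_zero_smul_E_smul_ne_zero e hw h0 r (by rw [Φ.Es_zero_smul_E_smul e hw, h, zero_smul])

theorem exists_Es_zero (V : Type*) [AddCommGroup V] [Module K V] [Module 𝒜 V]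
    [IsScalarTower K 𝒜 V] [IsSimpleModule 𝒜 V] (Φ : LeonardSystem K 𝒜 d) :
    ∃ w : V, Φ.Es 0 • w = w ∧ w ≠ 0 := by
  obtain ⟨b, -, hb⟩ := Φ.dual.exists_eigenbasis V e
  refine ⟨b 0, ?_, b.ne_zero 0⟩
  change Φ.dual.E 0 • _ = _
  simp [hb]

end Tridiagonal
end LeonardSystem

/-! ### Evaluating the polynomials `τ` and `η` -/

section SplitPolynomials

variable {K : Type*} [Field K] {d : ℕ}

theorem eval_tauPoly (θ : Fin (d + 1) → K) (i : ℕ) (x : K) :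
    (tauPoly θ i).eval x =
      ∏ j ∈ Finset.univ.filter (fun j : Fin (d + 1) => j.val < i), (x - θ j) := by
  simp [tauPoly, eval_prod]

theorem eval_tauPoly_eq_zero (θ : Fin (d + 1) → K) {i : ℕ} {j : Fin (d + 1)} (h : j.val < i) :
    (tauPoly θ i).eval (θ j) = 0 := by
  rw [eval_tauPoly]
  exact Finset.prod_eq_zero (i := j) (by simpa using h) (sub_self _)

theorem eval_tauPoly_ne_zero {θ : Fin (d + 1) → K} (hθ : Function.Injective θ) {i : ℕ}
    {j : Fin (d + 1)} (h : i ≤ j.val) : (tauPoly θ i).eval (θ j) ≠ 0 := by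
  rw [eval_tauPoly, Finset.prod_ne_zero_iff]
  intro k hk hkj
  rw [hθ (sub_eq_zero.1 hkj)] at h
  simp at hk
  omega

theorem etaPoly_eq_tauPoly (θ : Fin (d + 1) → K) (i : ℕ) :
    etaPoly θ i = tauPoly (θ ∘ Fin.rev) i := rfl

end SplitPolynomials

namespace LeonardSystem

/-! ### The six bases -/

section Bases

variable {K 𝒜 : Type*} [Field K] [Ring 𝒜] [Algebra K 𝒜] {d : ℕ}
  {V : Type*} [AddCommGroup V] [Module K V] [Module 𝒜 V]
  [IsScalarTower K 𝒜 V] [IsSimpleModule 𝒜 V]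

theorem linearIndependent_span_comp_rev {u : Fin (d + 1) → V}
    (hu : LinearIndependent K u ∧ Submodule.span K (Set.range u) = ⊤) :
    LinearIndependent K (u ∘ Fin.rev) ∧ Submodule.span K (Set.range (u ∘ Fin.rev)) = ⊤ :=
  ⟨hu.1.comp _ Fin.rev_injective, by rw [Fin.rev_surjective.range_comp]; exact hu.2⟩

/-- If the values `p_i(θ_{σ j})` form a triangular matrix with nonzero diagonal, then the vectors
`p_i(A) w` form a basis. -/
theorem linearIndependent_span_aeval (e : 𝒜 ≃ₐ[K] Matrix (Fin (d + 1)) (Fin (d + 1)) K)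
    (Φ : LeonardSystem K 𝒜 d) {w : V} (hw : ∀ i, Φ.E i • w ≠ 0)
    (σ : Fin (d + 1) → Fin (d + 1)) (p : Fin (d + 1) → K[X])
    (hlt : ∀ i j, j < i → (p i).eval (Φ.θ (σ j)) = 0) (hself : ∀ i, (p i).eval (Φ.θ (σ i)) ≠ 0) :
    LinearIndependent K (fun i => aeval Φ.A (p i) • w) ∧
      Submodule.span K (Set.range fun i => aeval Φ.A (p i) • w) = ⊤ := by
  obtain ⟨hfin, hrank⟩ := finrank_eq_of_matrixAlgEquiv V e
  have hli : LinearIndependent K (fun i => aeval Φ.A (p i) • w) := by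
    rw [Fintype.linearIndependent_iff]
    intro g hg i
    induction i using WellFoundedLT.induction with
    | ind i ih =>
    have h := congrArg (Φ.E (σ i) • ·) hg
    simp only [Finset.smul_sum, smul_zero] at h
    rw [Finset.sum_eq_single i] at h
    · rw [smul_comm, E_smul_aeval_smul e] at h
      exact (smul_eq_zero.1 h).resolve_right (smul_ne_zero (hself i) (hw _))
    · intro k _ hk
      rcases lt_or_gt_of_ne hk with hk | hk
      · rw [ih k hk, zero_smul, smul_zero]
      · rw [smul_comm, E_smul_aeval_smul e, hlt k i hk, zero_smul, smul_zero]
    · simp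
  exact ⟨hli, hli.span_eq_top_of_card_eq_finrank (by simp [hrank])⟩

theorem linearIndependent_span_of_mem_sequencesA
    (e : 𝒜 ≃ₐ[K] Matrix (Fin (d + 1)) (Fin (d + 1)) K) (Φ : LeonardSystem K 𝒜 d)
    {X : Fin (d + 1) → 𝒜} (hX : X ∈ Φ.sequencesA) {w : V} (hw : ∀ i, Φ.E i • w ≠ 0) :
    LinearIndependent K (fun i => X i • w) ∧
      Submodule.span K (Set.range fun i => X i • w) = ⊤ := by
  have hE := Φ.linearIndependent_span_of_E e hw
    fun i => by rw [E_smul_E_smul e, if_pos rfl]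
  have htau := Φ.linearIndependent_span_aeval e hw id (fun i => Φ.tau i)
    (fun i j h => eval_tauPoly_eq_zero Φ.θ h) (fun i => eval_tauPoly_ne_zero Φ.θ_injective le_rfl)
  have heta := Φ.linearIndependent_span_aeval e hw Fin.rev (fun i => Φ.eta i)
    (fun i j h => eval_tauPoly_eq_zero (Φ.θ ∘ Fin.rev) h)
    (fun i => eval_tauPoly_ne_zero (Φ.θ_injective.comp Fin.rev_injective) le_rfl)
  have hrev : ∀ i : Fin (d + 1), d - i.val = i.rev.val := fun i => by rw [Fin.val_rev]; omega
  simp only [sequencesA, hrev, Set.mem_insert_iff, Set.mem_singleton_iff] at hX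
  rcases hX with rfl | rfl | rfl | rfl | rfl | rfl
  · exact hE
  · exact linearIndependent_span_comp_rev hE
  · exact htau
  · exact linearIndependent_span_comp_rev htau
  · exact heta
  · exact linearIndependent_span_comp_rev heta

end Bases

/-! ### Existence of the antiautomorphism and of the form -/

section Form

variable {K 𝒜 : Type*} [Field K] [Ring 𝒜] [Algebra K 𝒜] {d : ℕ}

/-- An irreducible tridiagonal matrix is symmetrized by a diagonal one, whose entries are partial
products of the ratios of superdiagonal to subdiagonal entries. -/
theorem exists_diagonal_symmetrizing (a : Matrix (Fin (d + 1)) (Fin (d + 1)) K)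
    (h0 : ∀ i j : Fin (d + 1), 1 < |(i : ℤ) - j| → a i j = 0)
    (h1 : ∀ i j : Fin (d + 1), |(i : ℤ) - j| = 1 → a i j ≠ 0) :
    ∃ k : Fin (d + 1) → K, (∀ i, k i ≠ 0) ∧ ∀ i j, k i * a i j = a j i * k j := by
  let r : ℕ → K := fun m =>
    if h : m + 1 < d + 1 then a ⟨m, by omega⟩ ⟨m + 1, h⟩ / a ⟨m + 1, h⟩ ⟨m, by omega⟩ else 1
  have hr : ∀ m, r m ≠ 0 := by
    intro m
    by_cases h : m + 1 < d + 1
    · simp only [r, dif_pos h]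
      exact div_ne_zero (h1 _ _ (by simp)) (h1 _ _ (by simp))
    · simp only [r, dif_neg h]
      exact one_ne_zero
  have hsucc : ∀ i j : Fin (d + 1), i.val + 1 = j.val →
      (∏ m ∈ Finset.range i, r m) * a i j = a j i * ∏ m ∈ Finset.range j, r m := by
    rintro ⟨i, hi⟩ ⟨j, hj⟩ h
    obtain rfl : i + 1 = j := h
    have : a ⟨i + 1, hj⟩ ⟨i, hi⟩ ≠ 0 := h1 _ _ (by simp)
    simp only [Finset.prod_range_succ, r, dif_pos hj]
    field_simp
  refine ⟨fun i => ∏ m ∈ Finset.range i, r m, fun i => Finset.prod_ne_zero_iff.2 fun m _ => hr m,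
    fun i j => ?_⟩
  rcases lt_trichotomy i j with h | rfl | h
  · by_cases hij : i.val + 1 = j.val
    · exact hsucc i j hij
    · have h2 : i.val < j.val := h
      rw [h0 i j, h0 j i, mul_zero, zero_mul]
      · rw [abs_of_pos] <;> omega
      · rw [abs_of_neg] <;> omega
  · exact mul_comm _ _
  · by_cases hij : j.val + 1 = i.val
    · rw [mul_comm, ← hsucc j i hij, mul_comm]
    · have h2 : j.val < i.val := h
      rw [h0 i j, h0 j i, mul_zero, zero_mul]
      · rw [abs_of_neg] <;> omega
      · rw [abs_of_pos] <;> omega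

/-- In an eigenbasis of `A*` take the diagonal form `D` that symmetrizes the matrix of `A`; its adjoint
`x ↦ D⁻¹ xᵀ D` then fixes `A`, and it fixes every diagonal matrix, in particular `A*`. -/
theorem exists_isAssociatedForm (V : Type*) [AddCommGroup V] [Module K V] [Module 𝒜 V]
    [IsScalarTower K 𝒜 V] [IsSimpleModule 𝒜 V]
    (e : 𝒜 ≃ₐ[K] Matrix (Fin (d + 1)) (Fin (d + 1)) K) (Φ : LeonardSystem K 𝒜 d) :
    ∃ b : LinearMap.BilinForm K V, Φ.IsAssociatedForm b := by
  obtain ⟨v, hAs, hEs⟩ := Φ.dual.exists_eigenbasis V e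
  obtain ⟨ρ, hρ, -⟩ := exists_actionEquiv V e
  let ψ : 𝒜 ≃ₐ[K] Matrix (Fin (d + 1)) (Fin (d + 1)) K := ρ.trans (LinearMap.toMatrixAlgEquiv v)
  have hψ : ∀ x i j, ψ x i j = v.repr (x • v j) i := fun x i j => by
    rw [← hρ]; exact LinearMap.toMatrixAlgEquiv_apply v (ρ x) i j
  have hψv : ∀ x u, v.equivFun (x • u) = (ψ x).mulVec (v.equivFun u) := fun x u => by
    rw [← hρ]; exact (LinearMap.toMatrix_mulVec_repr v v (ρ x) u).symm
  have hEAE : ∀ i j u, (Φ.Es i * Φ.A * Φ.Es j) • u = v.repr u j • ψ Φ.A i j • v i := by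
    intro i j u
    have h : ∀ i u, Φ.Es i • u = v.repr u i • v i := hEs
    rw [mul_smul, mul_smul, h j, smul_comm Φ.A (v.repr u j), smul_comm (Φ.Es i) (v.repr u j), h, hψ]
  obtain ⟨k, hk, hka⟩ := exists_diagonal_symmetrizing (ψ Φ.A)
    (fun i j hij => by
      have h := hEAE i j (v j)
      rw [Φ.Es_A_Es_eq_zero i j hij, zero_smul] at h
      rw [Module.Basis.repr_self, Finsupp.single_eq_same, one_smul] at h
      exact (smul_eq_zero.1 h.symm).resolve_right (v.ne_zero i))
    (fun i j hij h => Φ.Es_A_Es_ne_zero i j hij <| ext_of_smul V e fun u => by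
      rw [hEAE, h, zero_smul, smul_zero, zero_smul])
  let D : Matrix (Fin (d + 1)) (Fin (d + 1)) K := Matrix.diagonal k
  let D' : Matrix (Fin (d + 1)) (Fin (d + 1)) K := Matrix.diagonal k⁻¹
  have hDD' : D * D' = 1 := by simp [D, D', hk]
  have hD'D : D' * D = 1 := by simp [D, D', hk]
  let f : 𝒜 →ₗ[K] 𝒜 :=
    { toFun := fun x => ψ.symm (D' * (ψ x).transpose * D)
      map_add' := fun x y => by
        rw [map_add, Matrix.transpose_add, mul_add, add_mul, map_add]
      map_smul' := fun c x => by
        rw [map_smul, Matrix.transpose_smul, Matrix.mul_smul, Matrix.smul_mul, map_smul]; rfl }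
  have hf : ∀ x, ψ (f x) = D' * (ψ x).transpose * D := fun x => ψ.apply_symm_apply _
  have hfix : ∀ x, (∀ i j, k i * ψ x i j = ψ x j i * k j) → f x = x := fun x hx => by
    apply ψ.injective
    ext i j
    rw [hf, Matrix.mul_diagonal, Matrix.diagonal_mul, Matrix.transpose_apply, mul_assoc, ← hx,
      Pi.inv_apply, inv_mul_cancel_left₀ (hk i)]
  have hinv : Function.Involutive f := fun x => by
    apply ψ.injective
    rw [hf, hf, Matrix.transpose_mul, Matrix.transpose_mul, Matrix.transpose_transpose]
    simp only [D, D', Matrix.diagonal_transpose]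
    change D' * (D * (ψ x * D')) * D = _
    rw [← mul_assoc, hD'D, one_mul, mul_assoc, hD'D, mul_one]
  refine ⟨(Matrix.toBilin' D).comp v.equivFun.toLinearMap v.equivFun.toLinearMap, ?_,
    LinearEquiv.ofInvolutive f hinv, ⟨fun x y => ?_, hfix _ hka, hfix _ fun i j => ?_⟩,
    fun x u w => ?_⟩
  · intro h
    have h := congrArg (fun B => B (v 0) (v 0)) h
    have h0 : v.equivFun (v 0) = Pi.single 0 1 := by
      ext j
      simp [Pi.single_apply, eq_comm]
    change Matrix.toBilin' D (v.equivFun (v 0)) (v.equivFun (v 0)) = 0 at h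
    rw [h0, Matrix.toBilin'_single] at h
    exact hk 0 ((Matrix.diagonal_apply_eq k 0).symm.trans h)
  · apply ψ.injective
    change ψ (f _) = ψ (f _ * f _)
    rw [hf, map_mul, map_mul, hf, hf, Matrix.transpose_mul]
    calc _ = D' * (ψ y).transpose * 1 * (ψ x).transpose * D := by simp only [mul_assoc, one_mul]
      _ = _ := by rw [← hDD']; simp only [mul_assoc]
  · have h : ∀ i, Φ.As • v i = Φ.θs i • v i := hAs
    rw [hψ, hψ, h, h]
    by_cases hij : i = j
    · subst hij; exact mul_comm _ _
    · simp [hij, Ne.symm hij]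
  · change Matrix.toBilin' D (v.equivFun (x • u)) (v.equivFun w) =
      Matrix.toBilin' D (v.equivFun u) (v.equivFun (f x • w))
    rw [hψv, hψv, hf, Matrix.toBilin'_apply', Matrix.toBilin'_apply', Matrix.mulVec_mulVec,
      ← mul_assoc, ← mul_assoc, hDD', one_mul, dotProduct_comm, Matrix.dotProduct_mulVec,
      ← Matrix.mulVec_transpose, dotProduct_comm, Matrix.mulVec_mulVec]

end Form
end LeonardSystem

/-! ### Degrees and divisibility for the polynomials `τ` and `η` -/

section SplitPolynomials

variable {K : Type*} [Field K] {d : ℕ}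

theorem tauPoly_monic (θ : Fin (d + 1) → K) (i : ℕ) : (tauPoly θ i).Monic :=
  monic_prod_X_sub_C _ _

theorem card_filter_val_lt {i : ℕ} (hi : i ≤ d + 1) :
    (Finset.univ.filter fun j : Fin (d + 1) => j.val < i).card = i := by
  rw [Fin.card_filter_val_lt, min_eq_right hi]

theorem natDegree_tauPoly (θ : Fin (d + 1) → K) {i : ℕ} (hi : i ≤ d + 1) :
    (tauPoly θ i).natDegree = i := by
  rw [tauPoly, natDegree_prod_of_monic _ _ fun j _ => monic_X_sub_C (θ j)]
  simp [card_filter_val_lt hi]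

theorem coeff_tauPoly (θ : Fin (d + 1) → K) {i : ℕ} (hi : i ≤ d + 1) :
    (tauPoly θ i).coeff i = 1 := by
  have h := (tauPoly_monic θ i).coeff_natDegree
  rwa [natDegree_tauPoly θ hi] at h

/-- A polynomial of degree at most `i` with the `i` roots of `τ_i` is a multiple of `τ_i`. -/
theorem eq_C_mul_tauPoly {θ : Fin (d + 1) → K} (hθ : Function.Injective θ) {i : ℕ}
    (hi : i ≤ d + 1) {p : K[X]} (hp : p.natDegree ≤ i)
    (h : ∀ j : Fin (d + 1), j.val < i → p.eval (θ j) = 0) :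
    p = C (p.coeff i) * tauPoly θ i := by
  rw [← sub_eq_zero]
  refine eq_zero_of_degree_lt_of_eval_index_eq_zero
    (v := θ) (Finset.univ.filter fun j : Fin (d + 1) => j.val < i) hθ.injOn ?_ fun j hj => ?_
  · rw [card_filter_val_lt hi, degree_lt_iff_coeff_zero]
    intro m hm
    rw [coeff_sub, coeff_C_mul]
    rcases hm.eq_or_lt with rfl | hm
    · rw [coeff_tauPoly θ hi, mul_one, sub_self]
    · rw [coeff_eq_zero_of_natDegree_lt (hp.trans_lt hm),
        coeff_eq_zero_of_natDegree_lt ((natDegree_tauPoly θ hi).trans_lt hm), mul_zero, sub_zero]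
  · have hj : j.val < i := by simpa using hj
    rw [eval_sub, eval_mul, h j hj, eval_tauPoly_eq_zero θ hj, mul_zero, sub_zero]

theorem eval_tauPoly_mul_eval_etaPoly (θ : Fin (d + 1) → K) (r : Fin (d + 1)) :
    (tauPoly θ r).eval (θ r) * (etaPoly θ (d - r)).eval (θ r) =
      ∏ j ∈ Finset.univ.erase r, (θ r - θ j) := by
  have h1 : (etaPoly θ (d - r)).eval (θ r) =
      ∏ j ∈ Finset.univ.filter (fun j : Fin (d + 1) => r < j), (θ r - θ j) := by
    rw [etaPoly_eq_tauPoly, eval_tauPoly]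
    refine Finset.prod_nbij' Fin.rev Fin.rev ?_ ?_ ?_ ?_ ?_
    · intro j hj
      simp only [Finset.mem_filter, Finset.mem_univ, true_and, Fin.lt_def, Fin.val_rev] at hj ⊢
      omega
    · intro j hj
      simp only [Finset.mem_filter, Finset.mem_univ, true_and, Fin.lt_def, Fin.val_rev] at hj ⊢
      omega
    · simp
    · simp
    · simp
  rw [h1, eval_tauPoly, ← Finset.prod_union]
  · congr 1
    ext j
    simp only [Finset.mem_union, Finset.mem_filter, Finset.mem_univ, true_and, Finset.mem_erase,
      and_true, ← Fin.lt_def]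
    exact lt_or_lt_iff_ne
  · rw [Finset.disjoint_filter]
    intro j _ h h'
    exact lt_asymm h h'

end SplitPolynomials

namespace LeonardSystem

/-! ### Orthogonality for associated forms -/

section AssociatedForm

variable {K 𝒜 : Type*} [Field K] [Ring 𝒜] [Algebra K 𝒜] {d : ℕ}
  {V : Type*} [AddCommGroup V] [Module K V] [Module 𝒜 V] {Φ : LeonardSystem K 𝒜 d}
  {b : LinearMap.BilinForm K V}

theorem IsAssociatedForm.dual (hb : Φ.IsAssociatedForm b) : Φ.dual.IsAssociatedForm b := by
  obtain ⟨h0, σ, ⟨hm, hA, hAs⟩, hσ⟩ := hb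
  exact ⟨h0, σ, ⟨hm, hAs, hA⟩, hσ⟩

variable [IsScalarTower K 𝒜 V]

theorem IsAssociatedForm.aeval_smul (hb : Φ.IsAssociatedForm b) (p : K[X]) (u v : V) :
    b (aeval Φ.A p • u) v = b u (aeval Φ.A p • v) := by
  obtain ⟨-, σ, ⟨-, hA, -⟩, hσ⟩ := hb
  induction p using Polynomial.induction_on' with
  | add p q hp hq => simp only [map_add, add_smul, LinearMap.add_apply, hp, hq]
  | monomial n a =>
    simp only [aeval_monomial, mul_smul, algebraMap_smul, map_smul, LinearMap.smul_apply]
    congr 1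
    induction n generalizing v with
    | zero => simp
    | succ n ih => rw [pow_succ', mul_smul, hσ, hA, ih, ← mul_smul, ← pow_succ, pow_succ']

theorem IsAssociatedForm.E_smul (hb : Φ.IsAssociatedForm b) (i : Fin (d + 1)) (u v : V) :
    b (Φ.E i • u) v = b u (Φ.E i • v) := by
  rw [Φ.E_eq]
  exact hb.aeval_smul _ u v

variable [IsSimpleModule 𝒜 V]

omit [IsScalarTower K 𝒜 V] in
/-- The left radical of an associated form is a proper submodule of the simple module `V`. -/
theorem IsAssociatedForm.exists_ne_zero (hb : Φ.IsAssociatedForm b) {u : V} (hu : u ≠ 0) :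
    ∃ v, b u v ≠ 0 := by
  obtain ⟨h0, σ, -, hσ⟩ := hb
  by_contra! h
  let N : Submodule 𝒜 V :=
    { carrier := {u | ∀ v, b u v = 0}
      add_mem' := fun {x y} hx hy v => by rw [map_add, LinearMap.add_apply, hx v, hy v, add_zero]
      zero_mem' := fun v => by simp
      smul_mem' := fun x y hy v => by rw [hσ, hy] }
  have hN : N = ⊤ := (eq_bot_or_eq_top N).resolve_left fun hN => hu <| by
    have hmem : u ∈ N := h
    rwa [hN] at hmem
  refine h0 (LinearMap.ext fun x => LinearMap.ext fun v => ?_)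
  have hmem : x ∈ N := hN ▸ Submodule.mem_top
  exact hmem v

theorem IsAssociatedForm.self_ne_zero (e : 𝒜 ≃ₐ[K] Matrix (Fin (d + 1)) (Fin (d + 1)) K)
    (hb : Φ.IsAssociatedForm b) {i : Fin (d + 1)} {u : V} (hu : Φ.E i • u = u) (h0 : u ≠ 0) :
    b u u ≠ 0 := by
  obtain ⟨v, hv⟩ := hb.exists_ne_zero h0
  obtain ⟨c, hc⟩ := Φ.exists_E_smul_eq e hu h0 v
  intro h
  rw [← hu, hb.E_smul, hc, map_smul, h, smul_zero] at hv
  exact hv rfl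

/-- `E_i` is the orthogonal projection onto the line `E_iV`. -/
theorem IsAssociatedForm.E_smul_eq (e : 𝒜 ≃ₐ[K] Matrix (Fin (d + 1)) (Fin (d + 1)) K)
    (hb : Φ.IsAssociatedForm b) {i : Fin (d + 1)} {u : V} (hu : Φ.E i • u = u) (h0 : u ≠ 0)
    (v : V) : Φ.E i • v = (b u v / b u u) • u := by
  obtain ⟨c, hc⟩ := Φ.exists_E_smul_eq e hu h0 v
  have h : b u v = c * b u u := by
    conv_lhs => rw [← hu, hb.E_smul, hc, map_smul, smul_eq_mul]
  rw [h, mul_div_cancel_right₀ _ (hb.self_ne_zero e hu h0), hc]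

theorem IsAssociatedForm.ne_zero (e : 𝒜 ≃ₐ[K] Matrix (Fin (d + 1)) (Fin (d + 1)) K)
    (hb : Φ.IsAssociatedForm b) {i : Fin (d + 1)} {u w : V} (hu : Φ.E i • u = u) (h0 : u ≠ 0)
    (hw : Φ.Es 0 • w = w) (hw0 : w ≠ 0) : b u w ≠ 0 := by
  intro h
  refine Φ.E_smul_ne_zero e hw hw0 i ?_
  rw [hb.E_smul_eq e hu h0, h, zero_div, zero_smul]

end AssociatedForm

/-! ### The second split sequence -/

section SplitSequence

variable {K 𝒜 : Type*} [Field K] [Ring 𝒜] [Algebra K 𝒜] {d : ℕ}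
  {V : Type*} [AddCommGroup V] [Module K V] [Module 𝒜 V]
  [IsScalarTower K 𝒜 V] [IsSimpleModule 𝒜 V]
  (e : 𝒜 ≃ₐ[K] Matrix (Fin (d + 1)) (Fin (d + 1)) K) (Φ : LeonardSystem K 𝒜 d)

include e

/-- A vector of `E*_0V + ⋯ + E*_iV` is `p(A) w` with `deg p ≤ i`. Interpolation provides `p`, since no
`E_i w` vanishes; its leading coefficient is seen in the dual eigenspace indexed by its degree. -/
theorem exists_aeval_smul_eq {w : V} (hw : Φ.Es 0 • w = w) (h0 : w ≠ 0) {v : V} {i : ℕ}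
    (hv : ∀ j : Fin (d + 1), i < j.val → Φ.Es j • v = 0) :
    ∃ p : K[X], p.natDegree ≤ i ∧ aeval Φ.A p • w = v := by
  choose c hc using fun i => Φ.exists_E_smul_eq e (i := i) (w := Φ.E i • w)
    (by rw [E_smul_E_smul e, if_pos rfl]) (Φ.E_smul_ne_zero e hw h0 i) v
  set p := Lagrange.interpolate Finset.univ Φ.θ c with hp
  have hpv : aeval Φ.A p • w = v := Φ.eq_of_E_smul_eq e fun i => by
    rw [E_smul_aeval_smul e, hp,
      Lagrange.eval_interpolate_at_node c Φ.θ_injective.injOn (Finset.mem_univ i), hc]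
  refine ⟨p, ?_, hpv⟩
  by_contra! hlt
  have hp0 : p ≠ 0 := by rintro h; simp [h] at hlt
  have hdeg : p.natDegree < d + 1 := by
    rw [natDegree_lt_iff_degree_lt hp0]
    exact (Lagrange.degree_interpolate_lt c Φ.θ_injective.injOn).trans_eq (by simp)
  have h := hv ⟨p.natDegree, hdeg⟩ hlt
  rw [← hpv, Φ.Es_smul_aeval_smul e hw le_rfl] at h
  exact smul_ne_zero (leadingCoeff_ne_zero.2 hp0)
    (Φ.Es_smul_pow_smul_ne_zero e hw h0 p.natDegree hdeg) h

theorem E_smul_aeval_eta_smul_eq_zero (w : V) {i : ℕ} {j : Fin (d + 1)} (h : j.rev.val < i) :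
    Φ.E j • aeval Φ.A (Φ.eta i) • w = 0 := by
  rw [E_smul_aeval_smul e, eta, etaPoly_eq_tauPoly]
  have := eval_tauPoly_eq_zero (Φ.θ ∘ Fin.rev) h
  rw [Function.comp_apply, Fin.rev_rev] at this
  rw [this, zero_smul]

theorem aeval_eta_smul_ne_zero {w : V} (hw : Φ.Es 0 • w = w) (h0 : w ≠ 0) {i : ℕ} (hi : i ≤ d) :
    aeval Φ.A (Φ.eta i) • w ≠ 0 := by
  intro h
  have h1 := Φ.E_smul_aeval_smul e (Φ.eta i) 0 w
  rw [h, smul_zero] at h1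
  have h2 := eval_tauPoly_ne_zero (Φ.θ_injective.comp Fin.rev_injective)
    (j := Fin.last d) (i := i) (by simpa using hi)
  rw [Function.comp_apply, Fin.rev_last] at h2
  exact smul_ne_zero h2 (Φ.E_smul_ne_zero e hw h0 0) h1.symm

theorem Es_smul_As_smul (j : Fin (d + 1)) (v : V) :
    Φ.Es j • Φ.As • v = Φ.θs j • Φ.Es j • v := by
  have h := Φ.dual.E_smul_aeval_smul e X j v
  rwa [aeval_X, eval_X] at h

theorem E_smul_As_smul (j : Fin (d + 1)) (v : V) :
    Φ.E j • Φ.As • v = ∑ i, (Φ.E j * Φ.As * Φ.E i) • v :=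
  Φ.dual.Es_smul_A_smul e j v

/-- `A* - θ*_{i+1}` maps `η_{i+1}(A) w` to a nonzero multiple of `η_i(A) w`: the image lies both
in `E*_0V + ⋯ + E*_iV` and in `E_0V + ⋯ + E_{d-i}V`, which meet in the line through `η_i(A) w`. -/
theorem exists_As_smul_eta_smul {w : V} (hw : Φ.Es 0 • w = w) (h0 : w ≠ 0) (i : Fin d) :
    ∃ c : K, c ≠ 0 ∧ Φ.As • aeval Φ.A (Φ.eta (i + 1)) • w -
      Φ.θs i.succ • aeval Φ.A (Φ.eta (i + 1)) • w = c • aeval Φ.A (Φ.eta i) • w := by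
  set u : V := aeval Φ.A (Φ.eta (i + 1)) • w with hu
  have hid := i.isLt
  obtain ⟨p, hpdeg, hp⟩ := Φ.exists_aeval_smul_eq e hw h0
    (v := Φ.As • u - Φ.θs i.succ • u) (i := i) fun j hj => by
      rw [smul_sub, Es_smul_As_smul e, smul_comm (Φ.Es j) (Φ.θs i.succ), ← sub_smul]
      by_cases hji : j = i.succ
      · rw [hji, sub_self, zero_smul]
      · rw [hu, Φ.Es_smul_aeval_smul_eq_zero e hw, smul_zero]
        rw [eta, etaPoly_eq_tauPoly, natDegree_tauPoly _ (by omega)]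
        have : j.val ≠ i + 1 := fun h => hji (Fin.ext h)
        omega
  have hroot : ∀ j : Fin (d + 1), j.val < i → p.eval ((Φ.θ ∘ Fin.rev) j) = 0 := by
    intro j hj
    have hE : Φ.E j.rev • (Φ.As • u - Φ.θs i.succ • u) = 0 := by
      rw [smul_sub, smul_comm (Φ.E j.rev) (Φ.θs i.succ), hu,
        E_smul_aeval_eta_smul_eq_zero e Φ w (by rw [Fin.rev_rev]; omega), smul_zero, sub_zero,
        E_smul_As_smul e]
      refine Finset.sum_eq_zero fun k _ => ?_
      by_cases hk : k.rev.val < i + 1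
      · rw [mul_smul, E_smul_aeval_eta_smul_eq_zero e Φ w hk, smul_zero]
      · rw [Φ.E_As_E_eq_zero, zero_smul]
        rw [Fin.val_rev] at hk ⊢
        rw [abs_of_pos] <;> omega
    rw [← hp, E_smul_aeval_smul e] at hE
    exact (smul_eq_zero.1 hE).resolve_right (Φ.E_smul_ne_zero e hw h0 _)
  have hpeq := eq_C_mul_tauPoly (Φ.θ_injective.comp Fin.rev_injective) (by omega) hpdeg hroot
  refine ⟨p.coeff i, fun hc => ?_, ?_⟩
  · -- If `c = 0`, then `u` is an eigenvector of `A*` lying in `E_0V + ⋯ + E_{d-i-1}V`, hence is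
    -- `q(A*) w'` with `w' ∈ E_0V` and `deg q < d`. But then `q` has `d` roots, so `u = 0`.
    rw [hc, C_0, zero_mul] at hpeq
    rw [hpeq, map_zero, zero_smul] at hp
    obtain ⟨w', hw', h0'⟩ := Φ.dual.exists_Es_zero e V
    obtain ⟨q, hqdeg, hq⟩ := Φ.dual.exists_aeval_smul_eq e hw' h0' (v := u) (i := d - (i + 1))
      fun j hj => Φ.E_smul_aeval_eta_smul_eq_zero e w (by rw [Fin.val_rev]; omega)
    have hq0 : q = 0 := by
      refine eq_zero_of_degree_lt_of_eval_index_eq_zero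
        (v := Φ.θs) (Finset.univ.erase i.succ) Φ.θs_injective.injOn ?_ fun j hj => ?_
      · refine (degree_le_of_natDegree_le hqdeg).trans_lt ?_
        rw [Finset.card_erase_of_mem (Finset.mem_univ _), Finset.card_univ, Fintype.card_fin]
        exact_mod_cast (by omega : d - (i.val + 1) < d + 1 - 1)
      · have h1 : Φ.Es j • (Φ.As • u - Φ.θs i.succ • u) = 0 := by rw [← hp, smul_zero]
        rw [smul_sub, Es_smul_As_smul e, smul_comm (Φ.Es j) (Φ.θs i.succ), ← sub_smul] at h1
        have h2 : Φ.Es j • u = 0 := (smul_eq_zero.1 h1).resolve_left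
          (sub_ne_zero.2 fun h => (Finset.mem_erase.1 hj).1 (Φ.θs_injective h))
        have h3 := Φ.dual.E_smul_aeval_smul e q j w'
        rw [hq] at h3
        exact (smul_eq_zero.1 (h3.symm.trans h2)).resolve_right
          (Φ.dual.E_smul_ne_zero e hw' h0' j)
    rw [hq0, map_zero, zero_smul] at hq
    exact Φ.aeval_eta_smul_ne_zero e hw h0 (by omega) hq.symm
  · rw [← hp]
    conv_lhs => rw [hpeq]
    rw [map_mul, aeval_C, mul_smul, algebraMap_smul]
    rfl

theorem algTrace_smul_Es_zero {w : V} (hw : Φ.Es 0 • w = w) (x : 𝒜) :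
    algTrace e (x * Φ.Es 0) • w = Φ.Es 0 • x • w :=
  Φ.dual.algTrace_smul e x hw

/-- Apply `E*_0`, on whose image `A*` acts as `θ*_0`, to the relation in the hypothesis. -/
theorem algTrace_eta_relation {w : V} (hw : Φ.Es 0 • w = w) (h0 : w ≠ 0) (i : Fin d) {c : K}
    (h : Φ.As • aeval Φ.A (Φ.eta (i + 1)) • w -
      Φ.θs i.succ • aeval Φ.A (Φ.eta (i + 1)) • w = c • aeval Φ.A (Φ.eta i) • w) :
    (Φ.θs 0 - Φ.θs i.succ) * algTrace e (aeval Φ.A (Φ.eta (i + 1)) * Φ.Es 0) =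
      c * algTrace e (aeval Φ.A (Φ.eta i) * Φ.Es 0) := by
  have h1 := congrArg (Φ.Es 0 • ·) h
  simp only [smul_sub, Es_smul_As_smul e] at h1
  rw [smul_comm (Φ.Es 0) (Φ.θs i.succ), smul_comm (Φ.Es 0) c, ← algTrace_smul_Es_zero e Φ hw,
    ← algTrace_smul_Es_zero e Φ hw, ← sub_smul, smul_smul, smul_smul] at h1
  exact smul_left_injective K h0 h1

theorem algTrace_eta_ne_zero {w : V} (hw : Φ.Es 0 • w = w) (h0 : w ≠ 0) {i : ℕ} (hi : i ≤ d) :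
    algTrace e (aeval Φ.A (Φ.eta i) * Φ.Es 0) ≠ 0 := by
  induction i with
  | zero =>
    intro h
    have h1 := Φ.algTrace_smul_Es_zero e hw (aeval Φ.A (Φ.eta 0))
    rw [h, zero_smul] at h1
    simp only [eta, etaPoly, not_lt_zero, Finset.filter_false, Finset.prod_empty, map_one,
      one_smul, hw] at h1
    exact h0 h1.symm
  | succ i ih =>
    obtain ⟨c, hc0, hc⟩ := Φ.exists_As_smul_eta_smul e hw h0 ⟨i, hi⟩
    have h := Φ.algTrace_eta_relation e hw h0 ⟨i, hi⟩ hc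
    exact right_ne_zero_of_mul (h.trans_ne (mul_ne_zero hc0 (ih (by omega))))

/-- The split relation `(A* - θ*_{i+1}) η_{i+1}(A) w = φ_{i+1} η_i(A) w`, with `φ_{i+1} ≠ 0`. -/
theorem As_smul_eta_smul {w : V} (hw : Φ.Es 0 • w = w) (h0 : w ≠ 0) (i : Fin d) :
    Φ.As • aeval Φ.A (Φ.eta (i + 1)) • w - Φ.θs i.succ • aeval Φ.A (Φ.eta (i + 1)) • w =
        Φ.secondSplit e i • aeval Φ.A (Φ.eta i) • w ∧ Φ.secondSplit e i ≠ 0 := by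
  obtain ⟨c, hc0, hc⟩ := Φ.exists_As_smul_eta_smul e hw h0 i
  have h := Φ.algTrace_eta_relation e hw h0 i hc
  have : Φ.secondSplit e i = c := by
    rw [secondSplit, mul_div_assoc', h,
      mul_div_cancel_right₀ _ (Φ.algTrace_eta_ne_zero e hw h0 (by omega))]
  rw [this]
  exact ⟨hc, hc0⟩

/-- As `u ∈ E_dV` is orthogonal to `η_i(A) w` for `i ≥ 1`, dividing `p` by `λ - θ*_i` and using the split
relation lowers both the degree and `i`, and leaves a factor `φ_i`. -/
theorem form_aeval_As_smul_eta_smul {w : V} (hw : Φ.Es 0 • w = w) (h0 : w ≠ 0)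
    {b : LinearMap.BilinForm K V} (hb : Φ.IsAssociatedForm b) {u : V}
    (hu : Φ.E (Fin.last d) • u = u) {i : ℕ} (hi : i ≤ d) {p : K[X]} (hp : p.natDegree ≤ i) :
    b u (aeval Φ.As p • aeval Φ.A (Φ.eta i) • w) =
      p.coeff i * (∏ m : Fin i, Φ.secondSplit e (Fin.castLE hi m)) * b u w := by
  induction i generalizing p with
  | zero =>
    rw [eq_C_of_natDegree_le_zero hp]
    simp [eta, etaPoly]
  | succ i ih =>
    set z : V := aeval Φ.A (Φ.eta (i + 1)) • w with hz
    have hbz : b u z = 0 := by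
      rw [← hu, hb.E_smul, hz, E_smul_aeval_eta_smul_eq_zero e Φ w (by simp), map_zero]
    obtain ⟨hs, -⟩ := Φ.As_smul_eta_smul e hw h0 ⟨i, hi⟩
    set t := Φ.θs (Fin.succ ⟨i, hi⟩) with ht
    set q := p /ₘ (X - C t) with hq
    have hpq : C (p.eval t) + (X - C t) * q = p := by
      rw [← modByMonic_X_sub_C_eq_C_eval, modByMonic_add_div]
    have hqdeg : q.natDegree ≤ i := by
      rw [hq, natDegree_divByMonic _ (monic_X_sub_C t), natDegree_X_sub_C]
      omega
    have hcoeff : p.coeff (i + 1) = q.coeff i := by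
      conv_lhs => rw [← hpq]
      rw [coeff_add, sub_mul, coeff_sub, coeff_X_mul, coeff_C_mul, coeff_C_succ,
        coeff_eq_zero_of_natDegree_lt (Nat.lt_succ_of_le hqdeg), mul_zero, sub_zero, zero_add]
    have hpz : aeval Φ.As p • z = p.eval t • z +
        Φ.secondSplit e ⟨i, hi⟩ • aeval Φ.As q • aeval Φ.A (Φ.eta i) • w := by
      conv_lhs => rw [← hpq]
      rw [map_add, aeval_C, add_smul, algebraMap_smul, mul_comm (X - C t), map_mul, mul_smul,
        smul_comm (Φ.secondSplit e _), ← hs, map_sub, aeval_X, aeval_C, sub_smul, algebraMap_smul]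
    rw [hpz, map_add, LinearMap.map_smul, LinearMap.map_smul, hbz, smul_zero, zero_add, ih (by omega) hqdeg, hcoeff,
      Fin.prod_univ_castSucc, smul_eq_mul]
    have : Fin.castLE hi (Fin.last i) = ⟨i, hi⟩ := rfl
    rw [this]
    have : ∀ m : Fin i, Fin.castLE hi m.castSucc = Fin.castLE (by omega) m := fun _ => rfl
    simp only [this]
    ring

/-- `τ*_d(A*) = τ*_d(θ*_d) E*_d`, because `τ*_d` vanishes at the other dual eigenvalues. -/
theorem aeval_taus_smul (v : V) :
    aeval Φ.As (Φ.taus d) • v =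
      (Φ.taus d).eval (Φ.θs (Fin.last d)) • Φ.Es (Fin.last d) • v := by
  refine Φ.dual.eq_of_E_smul_eq e fun j => ?_
  have h := Φ.dual.E_smul_aeval_smul e (Φ.taus d) j v
  refine h.trans ?_
  change (Φ.taus d).eval (Φ.θs j) • Φ.Es j • v = Φ.Es j • _
  rw [smul_comm (Φ.Es j) ((Φ.taus d).eval (Φ.θs (Fin.last d))), Es_smul_Es_smul e]
  split_ifs with hj
  · rw [hj]
  · rw [taus, eval_tauPoly_eq_zero, zero_smul, smul_zero]
    exact Fin.val_lt_last hj

theorem phi_mul_form {w : V} (hw : Φ.Es 0 • w = w) (h0 : w ≠ 0)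
    {b : LinearMap.BilinForm K V} (hb : Φ.IsAssociatedForm b) {u : V}
    (hu : Φ.E (Fin.last d) • u = u) :
    Φ.phi e * b u w = (Φ.taus d).eval (Φ.θs (Fin.last d)) *
      b u (Φ.Es (Fin.last d) • Φ.A ^ d • w) := by
  have h := Φ.form_aeval_As_smul_eta_smul e hw h0 hb hu le_rfl (p := Φ.taus d)
    (natDegree_tauPoly _ (by omega)).le
  rw [taus, coeff_tauPoly _ (by omega), ← taus, one_mul, aeval_taus_smul e,
    Φ.Es_smul_aeval_smul e hw (p := Φ.eta d)] at h
  · have h1 : (Φ.eta d).coeff (Fin.last d).val = 1 := coeff_tauPoly _ (by simp)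
    rw [h1, one_smul, map_smul, smul_eq_mul, Fin.val_last] at h
    exact h.symm
  · exact (natDegree_tauPoly _ (by omega)).le

theorem phi_ne_zero (V : Type*) [AddCommGroup V] [Module K V] [Module 𝒜 V]
    [IsScalarTower K 𝒜 V] [IsSimpleModule 𝒜 V] : Φ.phi e ≠ 0 := by
  obtain ⟨w, hw, h0⟩ := Φ.exists_Es_zero e V
  exact Finset.prod_ne_zero_iff.2 fun i _ => (Φ.As_smul_eta_smul e hw h0 i).2

/-- For every `r`, an explicit multiple of `E*_d E_r` maps `w ∈ E*_0V` to `w' ∈ E*_dV`. -/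
theorem smul_Es_last_smul_E_smul {w w' u : V} (hw : Φ.Es 0 • w = w) (h0 : w ≠ 0)
    (hw' : Φ.Es (Fin.last d) • w' = w') (h0' : w' ≠ 0)
    {b : LinearMap.BilinForm K V} (hb : Φ.IsAssociatedForm b)
    (hu : Φ.E (Fin.last d) • u = u) (hu0 : u ≠ 0) (r : Fin (d + 1)) :
    ((Φ.taus d).eval (Φ.θs (Fin.last d)) / Φ.phi e * (b u w' / b u w)) •
      ((Φ.tau r.val).eval (Φ.θ r) * (Φ.eta (d - r.val)).eval (Φ.θ r)) •
        Φ.Es (Fin.last d) • Φ.E r • w = w' := by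
  rw [tau, eta, eval_tauPoly_mul_eval_etaPoly, Φ.Es_last_smul_E_smul e hw,
    smul_inv_smul₀ (Φ.prod_theta_sub_ne_zero r)]
  have hphi := Φ.phi_mul_form e hw h0 hb hu
  have hphi0 := Φ.phi_ne_zero e V
  have hbuw := hb.ne_zero e hu hu0 hw h0
  obtain ⟨m, hm⟩ := Φ.dual.exists_E_smul_eq e (i := Fin.last d) hw' h0' (Φ.A ^ d • w)
  change Φ.Es (Fin.last d) • Φ.A ^ d • w = m • w' at hm
  rw [hm, map_smul, smul_eq_mul] at hphi
  rw [hm, smul_smul]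
  convert one_smul K w' using 2
  field_simp
  linear_combination -hphi

end SplitSequence

end LeonardSystem

namespace LeonardSystem

/-! ### Transition maps -/

section Transition

variable {K 𝒜 : Type*} [Field K] [Ring 𝒜] [Algebra K 𝒜] {d : ℕ}
  {V : Type*} [AddCommGroup V] [Module K V] [Module 𝒜 V]
  [IsScalarTower K 𝒜 V] [IsSimpleModule 𝒜 V]

/-- If `Y` maps `E_r w` to a suitable multiple of `w'` for every `r`, then the weighted sums of the
`X_r Y E_r` and of the `X_{d-r} Y E_r` are transition maps to the basis `X_i w'`. -/
theorem isTransitionMap_sum (e : 𝒜 ≃ₐ[K] Matrix (Fin (d + 1)) (Fin (d + 1)) K)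
    (Φ : LeonardSystem K 𝒜 d) {w w' : V} (hw : Φ.Es 0 • w = w) (h0 : w ≠ 0)
    {X : Fin (d + 1) → 𝒜} (hX : LinearIndependent K (fun i => X i • w') ∧
      Submodule.span K (Set.range fun i => X i • w') = ⊤)
    (a : K) (c : Fin (d + 1) → K) (Y : 𝒜) (hY : ∀ r, a • c r • Y • Φ.E r • w = w') :
    IsTransitionMap K (a • ∑ r, c r • (X r * Y * Φ.E r))
        (fun i => Φ.E i • w) (fun i => X i • w') ∧
      IsTransitionMap K (a • ∑ r, c r • (X r.rev * Y * Φ.E r))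
        (fun i => Φ.E i.rev • w) (fun i => X i • w') := by
  have hE := Φ.linearIndependent_span_of_E e (Φ.E_smul_ne_zero e hw h0)
    fun i => by rw [E_smul_E_smul e, if_pos rfl]
  have hact : ∀ (Z : Fin (d + 1) → 𝒜) (i : Fin (d + 1)),
      (a • ∑ r, c r • (Z r * Y * Φ.E r)) • Φ.E i • w = Z i • w' := by
    intro Z i
    rw [smul_assoc, Finset.sum_smul, Finset.sum_eq_single i]
    · rw [← hY i, smul_assoc, mul_smul, mul_smul, E_smul_E_smul e, if_pos rfl,
        smul_comm (Z i) a, smul_comm (Z i) (c i)]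
    · intro r _ hr
      rw [smul_assoc, mul_smul, E_smul_E_smul e, if_neg hr, smul_zero, smul_zero]
    · simp
  refine ⟨⟨hE, hX, hact X⟩, linearIndependent_span_comp_rev hE, hX, fun i => ?_⟩
  have h := hact (fun r => X r.rev) i.rev
  rwa [Fin.rev_rev] at h

end Transition

end LeonardSystem

theorem theorem10p2 {K 𝒜 V : Type*} [Field K] [Ring 𝒜] [Algebra K 𝒜]
    [AddCommGroup V] [Module K V] [Module 𝒜 V] [IsScalarTower K 𝒜 V] [IsSimpleModule 𝒜 V]
    (d : ℕ) (e : 𝒜 ≃ₐ[K] Matrix (Fin (d + 1)) (Fin (d + 1)) K)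
    (Φ : LeonardSystem K 𝒜 d) (ξ₀ ξd ξs₀ ξsd : V)
    (hξ₀ : ξ₀ ≠ 0) (hξd : ξd ≠ 0) (hξs₀ : ξs₀ ≠ 0) (hξsd : ξsd ≠ 0)
    (mξ₀ : ξ₀ ∈ Set.range (fun v : V => Φ.E 0 • v))
    (mξd : ξd ∈ Set.range (fun v : V => Φ.E (Fin.last d) • v))
    (mξs₀ : ξs₀ ∈ Set.range (fun v : V => Φ.Es 0 • v))
    (mξsd : ξsd ∈ Set.range (fun v : V => Φ.Es (Fin.last d) • v)) :
    -- the denominators do not vanish, and the bilinear form exists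
    (∀ r, algTrace e (Φ.E r * Φ.Es 0) ≠ 0) ∧ Φ.phi e ≠ 0 ∧
    (∃ b : LinearMap.BilinForm K V, Φ.IsAssociatedForm b) ∧
    ∀ b : LinearMap.BilinForm K V, Φ.IsAssociatedForm b →
      b ξ₀ ξs₀ ≠ 0 ∧ b ξd ξs₀ ≠ 0 ∧
      -- part (i)
      (∀ X ∈ Φ.sequencesA,
        IsTransitionMap K
          (∑ r, (algTrace e (Φ.E r * Φ.Es 0))⁻¹ • (X r * Φ.Es 0 * Φ.E r))
          (fun i => Φ.E i • ξs₀) (fun i => X i • ξs₀) ∧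
        IsTransitionMap K
          (((Φ.taus d).eval (Φ.θs (Fin.last d)) / Φ.phi e * (b ξd ξsd / b ξd ξs₀)) •
            ∑ r : Fin (d + 1),
              ((Φ.tau r.val).eval (Φ.θ r) * (Φ.eta (d - r.val)).eval (Φ.θ r)) •
                (X r * Φ.Es (Fin.last d) * Φ.E r))
          (fun i => Φ.E i • ξs₀) (fun i => X i • ξsd) ∧
        IsTransitionMap K
          (∑ r, (algTrace e (Φ.E r * Φ.Es 0))⁻¹ • (X r.rev * Φ.Es 0 * Φ.E r))
          (fun i => Φ.E i.rev • ξs₀) (fun i => X i • ξs₀) ∧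
        IsTransitionMap K
          (((Φ.taus d).eval (Φ.θs (Fin.last d)) / Φ.phi e * (b ξd ξsd / b ξd ξs₀)) •
            ∑ r : Fin (d + 1),
              ((Φ.tau r.val).eval (Φ.θ r) * (Φ.eta (d - r.val)).eval (Φ.θ r)) •
                (X r.rev * Φ.Es (Fin.last d) * Φ.E r))
          (fun i => Φ.E i.rev • ξs₀) (fun i => X i • ξsd)) ∧
      -- part (ii)
      (∀ X ∈ Φ.sequencesAs,
        IsTransitionMap K
          ((b ξ₀ ξ₀ / b ξ₀ ξs₀) •
            ∑ r, (algTrace e (Φ.E r * Φ.Es 0))⁻¹ • (X r * Φ.E 0 * Φ.Es 0 * Φ.E r))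
          (fun i => Φ.E i • ξs₀) (fun i => X i • ξ₀) ∧
        IsTransitionMap K
          ((b ξd ξd / b ξd ξs₀) •
            ∑ r, (algTrace e (Φ.E r * Φ.Es 0))⁻¹ •
              (X r * Φ.E (Fin.last d) * Φ.Es 0 * Φ.E r))
          (fun i => Φ.E i • ξs₀) (fun i => X i • ξd) ∧
        IsTransitionMap K
          ((b ξ₀ ξ₀ / b ξ₀ ξs₀) •
            ∑ r, (algTrace e (Φ.E r * Φ.Es 0))⁻¹ • (X r.rev * Φ.E 0 * Φ.Es 0 * Φ.E r))
          (fun i => Φ.E i.rev • ξs₀) (fun i => X i • ξ₀) ∧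
        IsTransitionMap K
          ((b ξd ξd / b ξd ξs₀) •
            ∑ r, (algTrace e (Φ.E r * Φ.Es 0))⁻¹ •
              (X r.rev * Φ.E (Fin.last d) * Φ.Es 0 * Φ.E r))
          (fun i => Φ.E i.rev • ξs₀) (fun i => X i • ξd)) := by
  have hid : ∀ i v, Φ.E i • (Φ.E i • v : V) = Φ.E i • v := fun i v => by
    rw [Φ.E_smul_E_smul e, if_pos rfl]
  have hids : ∀ i v, Φ.Es i • (Φ.Es i • v : V) = Φ.Es i • v := fun i v => by
    rw [Φ.Es_smul_Es_smul e, if_pos rfl]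
  replace mξ₀ : Φ.E 0 • ξ₀ = ξ₀ := by obtain ⟨v, rfl⟩ := mξ₀; exact hid _ _
  replace mξd : Φ.E (Fin.last d) • ξd = ξd := by obtain ⟨v, rfl⟩ := mξd; exact hid _ _
  replace mξs₀ : Φ.Es 0 • ξs₀ = ξs₀ := by obtain ⟨v, rfl⟩ := mξs₀; exact hids _ _
  replace mξsd : Φ.Es (Fin.last d) • ξsd = ξsd := by obtain ⟨v, rfl⟩ := mξsd; exact hids _ _
  have htr : ∀ r, algTrace e (Φ.E r * Φ.Es 0) ≠ 0 := fun r =>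
    Φ.algTrace_E_mul_Es_zero_ne_zero e mξs₀ hξs₀ r
  have hEs0 : ∀ r, (algTrace e (Φ.E r * Φ.Es 0))⁻¹ • Φ.Es 0 • Φ.E r • ξs₀ = ξs₀ := fun r => by
    rw [Φ.Es_zero_smul_E_smul e mξs₀, inv_smul_smul₀ (htr r)]
  refine ⟨htr, Φ.phi_ne_zero e V, Φ.exists_isAssociatedForm V e, fun b hb => ?_⟩
  have hb0 := hb.ne_zero e mξ₀ hξ₀ mξs₀ hξs₀
  have hbd := hb.ne_zero e mξd hξd mξs₀ hξs₀
  have hpart : ∀ i ξ, Φ.E i • ξ = ξ → ξ ≠ 0 → b ξ ξs₀ ≠ 0 → ∀ r,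
      (b ξ ξ / b ξ ξs₀) • (algTrace e (Φ.E r * Φ.Es 0))⁻¹ •
        (Φ.E i * Φ.Es 0) • Φ.E r • ξs₀ = ξ := by
    intro i ξ hξ hξ0 hbξ r
    rw [mul_smul, smul_comm _ (Φ.E i), hEs0, hb.E_smul_eq e hξ hξ0, smul_smul,
      div_mul_div_cancel₀ hbξ, div_self (hb.self_ne_zero e hξ hξ0), one_smul]
  refine ⟨hb0, hbd, fun X hX => ?_, fun X hX => ?_⟩
  · obtain ⟨h1, h3⟩ := Φ.isTransitionMap_sum e mξs₀ hξs₀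
      (Φ.linearIndependent_span_of_mem_sequencesA e hX (Φ.E_smul_ne_zero e mξs₀ hξs₀)) 1
      (fun r => (algTrace e (Φ.E r * Φ.Es 0))⁻¹) (Φ.Es 0) fun r => by rw [one_smul, hEs0]
    obtain ⟨h2, h4⟩ := Φ.isTransitionMap_sum e mξs₀ hξs₀
      (Φ.linearIndependent_span_of_mem_sequencesA e hX (Φ.E_smul_ne_zero' e mξsd hξsd)) _ _ _
      (Φ.smul_Es_last_smul_E_smul e mξs₀ hξs₀ mξsd hξsd hb mξd hξd)
    rw [one_smul] at h1 h3
    exact ⟨h1, h2, h3, h4⟩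
  · obtain ⟨h1, h3⟩ := Φ.isTransitionMap_sum e mξs₀ hξs₀
      (Φ.dual.linearIndependent_span_of_mem_sequencesA e hX
        (Φ.dual.E_smul_ne_zero e mξ₀ hξ₀)) _ _ _ (hpart 0 ξ₀ mξ₀ hξ₀ hb0)
    obtain ⟨h2, h4⟩ := Φ.isTransitionMap_sum e mξs₀ hξs₀
      (Φ.dual.linearIndependent_span_of_mem_sequencesA e hX
        (Φ.dual.E_smul_ne_zero' e mξd hξd)) _ _ _ (hpart (Fin.last d) ξd mξd hξd hbd)
    simp only [← mul_assoc] at h1 h2 h3 h4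
    exact ⟨h1, h2, h3, h4⟩
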